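/- Let $n\ge 3$ be an integer and put $m=\frac{n-2}{n+2}$. There is a constant $\kappa=\kappa(n)\in\mathbb R$, depending only on $n$, such that the following holds for all $\beta>0$ and $\lambda>0$. There is exactly one positive, radially symmetric function $u=u_{\beta,\lambda}\in C^2(\mathbb R^n)$ with $u(0)=\lambda$ that solves $$\frac{n-1}{m}\,\Delta u^m+\beta\,x\cdot\nabla u+\gamma u=0\quad\text{on }\mathbb R^n,\qquad \gamma=\frac{2\beta}{1-m},$$ and, with $r=|x|$, $$u_{\beta,\lambda}^{1-m}(x)=\frac{(n-1)(n-2)}{\beta r^2}\left\{\ln r+\left(\frac{2\ln\lambda}{n+2}+\frac{\ln\beta}{2}+\kappa(n)\right)+\frac{n-6}{4(n-2)}\,\frac1{\ln r}+o\!\left(\frac1{\ln r}\right)\right\}\qquad\text{as } r\to\infty .$$ -/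

import Mathlib

open scoped Laplacian Gradient

noncomputable section

/-- The fast diffusion exponent `m = (n - 2) / (n + 2)` of the conformally flat Yamabe flow on
`ℝⁿ`. -/
def yamabeExponent (n : ℕ) : ℝ := ((n : ℝ) - 2) / ((n : ℝ) + 2)

/-- `u` is a radially symmetric positive classical solution on all of `ℝⁿ` of
`((n - 1) / m) Δ(u ^ m) + β x · ∇u + γ u = 0`, where `m = (n - 2) / (n + 2)` and
`γ = 2 β / (1 - m)`, with the value `lam` at the origin. The positivity makes
`u ^ (1 - m) δᵢⱼ` a Riemannian metric. -/
structure IsRadialSteadySoliton (n : ℕ) (β lam : ℝ) (u : EuclideanSpace ℝ (Fin n) → ℝ) :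
    Prop where
  contDiff : ContDiff ℝ 2 u
  pos : ∀ x, 0 < u x
  radial : ∀ x y, ‖x‖ = ‖y‖ → u x = u y
  equation : ∀ x,
    ((n : ℝ) - 1) / yamabeExponent n * Δ (fun y => u y ^ yamabeExponent n) x
      + β * inner ℝ x (∇ u x) + 2 * β / (1 - yamabeExponent n) * u x = 0
  apply_zero : u 0 = lam

end

/-! Scaling reduces everything to one profile. Put `p = 1/m` and look for `u = lam * U(β lam^(1-m)
r²)^p`; then `U`, a function of `t = r²` with `U 0 = 1`, solves an equation containing only `n`.
Hence the only trace of `β` and `lam` in the asymptotics is a shift of `ln r` by half of `ln (β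
lam^(1-m))`, and the constant left over depends on `n` alone.

Existence (`exists_radial_profile`): integrated once, the radial equation gives `U'` at `t` through
`U` at `t` and a weighted average of `U^p` over the past, without a singularity at `t = 0`. For a
globally Lipschitz truncation of `x^p` a weighted contraction solves it globally. A first-zero
argument for `Y = (n-2)/2 * U + 2 t U'` shows that `Y > 0`. This forces `U' ≤ 0` and `0 < U ≤ 1`,
where the truncation is inactive.

Uniqueness (`IsRadialSteadySoliton.unique`): every soliton satisfies the same integrated equation
along rays, so a weighted supremum estimate applies to the difference of the values of `u^m`.

Asymptotics (`exists_expansion_of_cylindrical_system`): with `t = exp (2s)`, `w = t U^(p-1)` and `R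
= w'/w`, the equation becomes `w' = w R`, `R' = 4q - q R² - c w R`, where `q = (n-2)/4` and `c =
1/(n-1)`. The signs of `Y` and `U'` say exactly that `0 < R ≤ 2`. Then `w → ∞`, and `w' - 4q/c`
relaxes at the growing rate `c w` towards a small target. Two rounds of this give `w' = 4q/c +
(1-q)/(c s²) + o(1/s²)`, and integration yields the linear growth, the constant and the `1/s` term.
-/

open Filter Topology Set MeasureTheory

/-! ### Relaxation equations with a growing rate -/

/-- If `g' = -k (g - ℓ)` with `k → ∞`, then `g` is eventually bounded above by any strict upper
bound of `ℓ`. -/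
lemma eventually_le_of_relaxation {g k l : ℝ → ℝ} (hk : Continuous k)
    (hkt : Tendsto k atTop atTop)
    (hg : ∀ᶠ s in atTop, HasDerivAt g (-(k s) * (g s - l s)) s) {M : ℝ}
    (hl : ∀ᶠ s in atTop, l s ≤ M) {ε : ℝ} (hε : 0 < ε) : ∀ᶠ s in atTop, g s ≤ M + ε := by
  obtain ⟨s₀, hs₀⟩ := eventually_atTop.1 (hg.and (hl.and (hkt.eventually_ge_atTop 1)))
  -- `exp K` is the integrating factor: `(g - M) exp K` decreases once `l ≤ M`, and `k ≥ 1` beyond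
  -- `s₀` makes `exp (-K)` decay at least like `exp (-(s - s₀))`.
  set K : ℝ → ℝ := fun s => ∫ x in s₀..s, k x with hK
  have hKd : ∀ s, HasDerivAt K (k s) s := fun s =>
    intervalIntegral.integral_hasDerivAt_right (hk.intervalIntegrable _ _)
      hk.stronglyMeasurable.stronglyMeasurableAtFilter hk.continuousAt
  have hKge : ∀ s, s₀ ≤ s → s - s₀ ≤ K s := by
    intro s hs
    have := intervalIntegral.integral_mono_on hs (μ := volume)
      (f := fun _ => (1 : ℝ)) (g := k) intervalIntegrable_const (hk.intervalIntegrable _ _) (fun x hx => (hs₀ x hx.1).2.2)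
    simpa using this
  have hφd : ∀ s, s₀ ≤ s → HasDerivAt (fun s => (g s - M) * Real.exp (K s))
      (k s * (l s - M) * Real.exp (K s)) s := by
    intro s hs
    have := ((hs₀ s hs).1.sub_const M).mul (hKd s).exp
    exact this.congr_deriv (by ring)
  have hanti : AntitoneOn (fun s => (g s - M) * Real.exp (K s)) (Ici s₀) := by
    apply antitoneOn_of_deriv_nonpos (convex_Ici s₀)
    · exact fun s hs => (hφd s hs).continuousAt.continuousWithinAt
    · intro s hs
      rw [interior_Ici] at hs
      exact (hφd s hs.le).differentiableAt.differentiableWithinAt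
    · intro s hs
      rw [interior_Ici] at hs
      rw [(hφd s hs.le).deriv]
      have h := hs₀ s hs.le
      exact mul_nonpos_of_nonpos_of_nonneg
        (mul_nonpos_of_nonneg_of_nonpos (by linarith [h.2.2]) (by linarith [h.2.1]))
        (Real.exp_pos _).le
  have hlim : Tendsto (fun s => |g s₀ - M| * Real.exp (-(s - s₀))) atTop (𝓝 0) := by
    have : Tendsto (fun s : ℝ => Real.exp (-(s - s₀))) atTop (𝓝 0) :=
      Real.tendsto_exp_neg_atTop_nhds_zero.comp (tendsto_atTop_add_const_right _ (-s₀) tendsto_id)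
    simpa using this.const_mul (|g s₀ - M|)
  filter_upwards [hlim.eventually_le_const hε, eventually_ge_atTop s₀] with s h1 h2
  have h3 : (g s - M) * Real.exp (K s) ≤ |g s₀ - M| := by
    have := hanti (mem_Ici.2 le_rfl) h2 h2
    simp only [hK, intervalIntegral.integral_same, Real.exp_zero, mul_one] at this
    exact this.trans (le_abs_self _)
  have h4 : g s - M ≤ |g s₀ - M| * Real.exp (-K s) := by
    rw [Real.exp_neg, ← div_eq_mul_inv, le_div_iff₀ (Real.exp_pos _)]
    exact h3
  have h5 : Real.exp (-K s) ≤ Real.exp (-(s - s₀)) := Real.exp_le_exp.2 (by linarith [hKge s h2])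
  have := mul_le_mul_of_nonneg_left h5 (abs_nonneg (g s₀ - M))
  linarith

lemma eventually_ge_of_relaxation {g k l : ℝ → ℝ} (hk : Continuous k)
    (hkt : Tendsto k atTop atTop)
    (hg : ∀ᶠ s in atTop, HasDerivAt g (-(k s) * (g s - l s)) s) {M : ℝ}
    (hl : ∀ᶠ s in atTop, M ≤ l s) {ε : ℝ} (hε : 0 < ε) : ∀ᶠ s in atTop, M - ε ≤ g s := by
  have h := eventually_le_of_relaxation (g := fun s => -g s) (l := fun s => -l s) hk hkt
    (by
      filter_upwards [hg] with s hs
      exact hs.neg.congr_deriv (by ring)) (M := -M) (by filter_upwards [hl] with s hs; linarith) hε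
  filter_upwards [h] with s hs
  linarith

lemma tendsto_of_relaxation {g k l : ℝ → ℝ} (hk : Continuous k)
    (hkt : Tendsto k atTop atTop)
    (hg : ∀ᶠ s in atTop, HasDerivAt g (-(k s) * (g s - l s)) s) {L : ℝ}
    (hl : Tendsto l atTop (𝓝 L)) : Tendsto g atTop (𝓝 L) := by
  rw [Metric.tendsto_nhds]
  intro ε hε
  have h1 := eventually_le_of_relaxation hk hkt hg
    (hl.eventually_le_const (show L < L + ε / 4 by linarith)) (show 0 < ε / 4 by linarith)
  have h2 := eventually_ge_of_relaxation hk hkt hg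
    (hl.eventually_const_le (show L - ε / 4 < L by linarith)) (show 0 < ε / 4 by linarith)
  filter_upwards [h1, h2] with s h1 h2
  rw [Real.dist_eq, abs_lt]
  constructor <;> linarith

/-! ### Asymptotics of the cylindrical system -/

section ScaledSystem

variable {w R : ℝ → ℝ} {q c : ℝ}

/-- The quantity `G = w^q (R + c w)` has derivative `q w^q (4 + c w R)`, in which the negative terms
of `R'` have cancelled. As `w` increases, `G` grows at least linearly, which is impossible if `w`,
and with it `G`, stays bounded. -/
lemma tendsto_atTop_of_cylindrical_system (hq : 0 < q) (hc : 0 < c) (hw : ∀ s, 0 < w s)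
    (hR : ∀ s, 0 < R s) (hR2 : ∀ s, R s ≤ 2) (hwd : ∀ s, HasDerivAt w (w s * R s) s)
    (hRd : ∀ s, HasDerivAt R (4 * q - q * R s ^ 2 - c * w s * R s) s) :
    Tendsto w atTop atTop := by
  have hmono : Monotone w := monotone_of_deriv_nonneg (fun s => (hwd s).differentiableAt)
    (fun s => by rw [(hwd s).deriv]; exact (mul_pos (hw s) (hR s)).le)
  rcases tendsto_atTop_of_monotone hmono with h | ⟨l, hl⟩
  · exact h
  exfalso
  have hle : ∀ s, w s ≤ l := fun s => hmono.ge_of_tendsto hl s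
  have hl0 : 0 < l := (hw 0).trans_le (hle 0)
  set G : ℝ → ℝ := fun s => w s ^ q * (R s + c * w s) with hG
  have hGd : ∀ s, HasDerivAt G (w s ^ q * (q * (4 + c * w s * R s))) s := by
    intro s
    have h1 := (hwd s).rpow_const (p := q) (Or.inl (hw s).ne')
    have h2 := h1.mul ((hRd s).add ((hwd s).const_mul c))
    refine h2.congr_deriv ?_
    rw [Real.rpow_sub_one (hw s).ne']
    have := (hw s).ne'
    simp only [Pi.add_apply]
    field_simp
    ring
  have hge : ∀ s, 0 ≤ s → w 0 ^ q * (4 * q) * s ≤ G s := by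
    intro s hs
    have hm : MonotoneOn (fun s => G s - w 0 ^ q * (4 * q) * s) (Ici 0) := by
      have hd : ∀ s, HasDerivAt (fun s => G s - w 0 ^ q * (4 * q) * s)
          (w s ^ q * (q * (4 + c * w s * R s)) - w 0 ^ q * (4 * q)) s := by
        intro s
        exact ((hGd s).sub ((hasDerivAt_id s).const_mul (w 0 ^ q * (4 * q)))).congr_deriv (by simp)
      apply monotoneOn_of_deriv_nonneg (convex_Ici 0)
      · exact fun s _ => (hd s).continuousAt.continuousWithinAt
      · exact fun s _ => (hd s).differentiableAt.differentiableWithinAt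
      · intro s hs
        rw [interior_Ici] at hs
        rw [(hd s).deriv]
        have h1 : w 0 ^ q ≤ w s ^ q := Real.rpow_le_rpow (hw 0).le (hmono (le_of_lt hs)) hq.le
        have h2 : 0 < c * w s * R s := mul_pos (mul_pos hc (hw s)) (hR s)
        have h3 : q * 4 ≤ q * (4 + c * w s * R s) := by gcongr; linarith
        have h4 := mul_le_mul h1 h3 (by positivity) (Real.rpow_nonneg (hw s).le q)
        linarith
    have := hm (mem_Ici.2 le_rfl) hs hs
    simp only [mul_zero, sub_zero] at this
    have h0 : 0 < G 0 := mul_pos (Real.rpow_pos_of_pos (hw 0) q)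
      (add_pos (hR 0) (mul_pos hc (hw 0)))
    linarith
  have hGle : ∀ s, G s ≤ l ^ q * (2 + c * l) := by
    intro s
    have h1 : w s ^ q ≤ l ^ q := Real.rpow_le_rpow (hw s).le (hle s) hq.le
    have h2 : R s + c * w s ≤ 2 + c * l := add_le_add (hR2 s) (by gcongr; exact hle s)
    exact mul_le_mul h1 h2 (add_pos (hR s) (mul_pos hc (hw s))).le (Real.rpow_nonneg hl0.le q)
  have hb : 0 < w 0 ^ q * (4 * q) := mul_pos (Real.rpow_pos_of_pos (hw 0) q) (by linarith)
  have hB : 0 < l ^ q * (2 + c * l) := by positivity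
  have h1 := hge (l ^ q * (2 + c * l) / (w 0 ^ q * (4 * q)) + 1) (by positivity)
  have h2 := hGle (l ^ q * (2 + c * l) / (w 0 ^ q * (4 * q)) + 1)
  rw [mul_add, mul_div_cancel₀ _ hb.ne'] at h1
  linarith

/-- The trajectories of `w' = w R`, `R' = 4 q - q R² - c w R` expand linearly in time, with an
explicit coefficient of `1 / s`. -/
lemma exists_expansion_of_cylindrical_system (hq : 0 < q) (hc : 0 < c) (hw : ∀ s, 0 < w s)
    (hR : ∀ s, 0 < R s) (hR2 : ∀ s, R s ≤ 2) (hwd : ∀ s, HasDerivAt w (w s * R s) s)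
    (hRd : ∀ s, HasDerivAt R (4 * q - q * R s ^ 2 - c * w s * R s) s) :
    ∃ K : ℝ, Tendsto (fun s => s * (w s - 4 * q / c * s - K)) atTop (𝓝 ((q - 1) / c)) := by
  have hwt := tendsto_atTop_of_cylindrical_system hq hc hw hR hR2 hwd hRd
  have hwc : Continuous w := continuous_iff_continuousAt.2 fun s => (hwd s).continuousAt
  have hRc : Continuous R := continuous_iff_continuousAt.2 fun s => (hRd s).continuousAt
  set A : ℝ := 4 * q / c with hA
  have hA0 : 0 < A := by positivity
  set D : ℝ → ℝ := fun s => w s * R s - A with hD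
  -- The excess `D` of `w'` over its expected limit obeys a relaxation equation whose target is
  -- quadratic in `R`. This permits a bootstrap: a bounded target bounds `w R`, so `R → 0` since `w
  -- → ∞`, so the target and then `D` tend to zero.
  have hDd : ∀ s, HasDerivAt D (-(c * w s) * (D s - (1 - q) / c * R s ^ 2)) s := by
    intro s
    have := ((hwd s).mul (hRd s)).sub_const A
    refine this.congr_deriv ?_
    simp only [hD, hA]
    field_simp
    ring
  have hk : Continuous fun s => c * w s := by fun_prop
  have hkt : Tendsto (fun s => c * w s) atTop atTop := hwt.const_mul_atTop hc
  -- `D` is eventually bounded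
  have hRsq : ∀ s, R s ^ 2 ≤ 4 := fun s => by nlinarith [hR s, hR2 s]
  have hlb : ∀ s, |(1 - q) / c * R s ^ 2| ≤ |(1 - q) / c| * 4 := fun s => by
    rw [abs_mul, abs_of_nonneg (sq_nonneg (R s))]
    exact mul_le_mul_of_nonneg_left (hRsq s) (abs_nonneg _)
  have hD1 := eventually_le_of_relaxation hk hkt (Eventually.of_forall hDd)
    (M := |(1 - q) / c| * 4) (Eventually.of_forall fun s => (abs_le.1 (hlb s)).2) one_pos
  have hR0 : Tendsto R atTop (𝓝 0) := by
    have h1 : Tendsto (fun s => (|(1 - q) / c| * 4 + 1 + A) / w s) atTop (𝓝 0) :=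
      hwt.const_div_atTop _
    refine tendsto_of_tendsto_of_tendsto_of_le_of_le' tendsto_const_nhds h1
      (Eventually.of_forall fun s => (hR s).le) ?_
    filter_upwards [hD1] with s hs
    rw [le_div_iff₀ (hw s)]
    simp only [hD] at hs
    linarith
  have hD0 : Tendsto D atTop (𝓝 0) := by
    apply tendsto_of_relaxation hk hkt (Eventually.of_forall hDd)
    simpa using (hR0.pow 2).const_mul ((1 - q) / c)
  have hP : Tendsto (fun s => w s * R s) atTop (𝓝 A) := by
    have := hD0.add_const A
    simpa [hD] using this
  -- second order
  have hk2 : Continuous fun s => c * w s - 2 * R s := by fun_prop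
  have hk2t : Tendsto (fun s => c * w s - 2 * R s) atTop atTop := by
    have : Tendsto (fun s => -(2 * R s)) atTop (𝓝 0) := by simpa using (hR0.const_mul 2).neg
    simpa [sub_eq_add_neg] using hkt.atTop_add this
  -- Since `R` is of order `1 / w`, the target for `D` is of order `1 / w²`. Rescaling by `w²` costs
  -- `2 R` in the rate and gives a target with a nontrivial limit, obtained from `w R → A`.
  have hgd : ∀ᶠ s in atTop, HasDerivAt (fun s => w s ^ 2 * D s)
      (-(c * w s - 2 * R s) * (w s ^ 2 * D s
        - (1 - q) * (w s * R s) ^ 2 / (c - 2 * R s / w s))) s := by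
    filter_upwards [hk2t.eventually_gt_atTop 0] with s hs
    have := ((hwd s).pow 2).mul (hDd s)
    refine this.congr_deriv ?_
    have h1 := (hw s).ne'
    have h2 : c - 2 * R s / w s ≠ 0 := by
      have : c - 2 * R s / w s = (c * w s - 2 * R s) / w s := by field_simp
      rw [this]
      exact (div_pos hs (hw s)).ne'
    have h3 : w s * (c - 2 * R s / w s) = c * w s - 2 * R s := by field_simp
    rw [← h3]
    generalize c - 2 * R s / w s = e at h2 h3
    have h4 : -(w s * e) * (w s ^ 2 * D s - (1 - q) * (w s * R s) ^ 2 / e)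
        = -(w s * e) * (w s ^ 2 * D s) + w s * ((1 - q) * (w s * R s) ^ 2) := by
      field_simp
      ring
    rw [h4, h3]
    simp only [Pi.pow_apply, Nat.cast_ofNat]
    field_simp
    ring
  have hg : Tendsto (fun s => w s ^ 2 * D s) atTop (𝓝 ((1 - q) * A ^ 2 / c)) := by
    apply tendsto_of_relaxation hk2 hk2t hgd
    have h1 : Tendsto (fun s => 2 * R s / w s) atTop (𝓝 0) := by
      have : Tendsto (fun s => 2 * R s) atTop (𝓝 0) := by simpa using hR0.const_mul 2
      simpa [div_eq_mul_inv] using this.mul hwt.inv_tendsto_atTop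
    have h2 : Tendsto (fun s => c - 2 * R s / w s) atTop (𝓝 c) := by simpa using h1.const_sub c
    exact ((hP.pow 2).const_mul (1 - q)).div h2 hc.ne'
  -- `w` grows linearly
  set y : ℝ → ℝ := fun s => w s - A * s with hy
  have hyd : ∀ s, HasDerivAt y (D s) s := by
    intro s
    exact ((hwd s).sub ((hasDerivAt_id s).const_mul A)).congr_deriv (by simp [hD])
  -- Beyond `s₁` one has `w' ≥ A / 2`. The slope is halved again below, using `s ≥ 2 s₁`, to absorb
  -- the starting point. A linear lower bound on `w` makes `D = O(s⁻²)` integrable, whence the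
  -- constant `K`.
  obtain ⟨s₁, hs₁⟩ := eventually_atTop.1 (hD0.eventually_const_le (show -(A / 2) < 0 by linarith))
  have hlin : ∀ᶠ s in atTop, A / 4 * s ≤ w s := by
    have hm : MonotoneOn (fun s => w s - A / 2 * s) (Ici s₁) := by
      have hd : ∀ s, HasDerivAt (fun s => w s - A / 2 * s) (w s * R s - A / 2) s := by
        intro s
        exact ((hwd s).sub ((hasDerivAt_id s).const_mul (A / 2))).congr_deriv (by simp)
      apply monotoneOn_of_deriv_nonneg (convex_Ici s₁)
      · exact fun s _ => (hd s).continuousAt.continuousWithinAt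
      · exact fun s _ => (hd s).differentiableAt.differentiableWithinAt
      · intro s hs
        rw [interior_Ici] at hs
        rw [(hd s).deriv]
        have := hs₁ s (le_of_lt hs)
        simp only [hD] at this
        linarith
    filter_upwards [eventually_ge_atTop s₁, eventually_ge_atTop (2 * s₁)] with s hs hs'
    have := hm (mem_Ici.2 le_rfl) hs hs
    simp only at this
    nlinarith [hw s₁]
  have hDb : ∃ a C : ℝ, 0 < a ∧ ∀ s, a ≤ s → ‖D s‖ ≤ C * s ^ (-2 : ℝ) := by
    set B := |(1 - q) * A ^ 2 / c| + 1 with hB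
    have hgb : ∀ᶠ s in atTop, |w s ^ 2 * D s| ≤ B :=
      hg.abs.eventually_le_const (by simp [hB])
    obtain ⟨a, ha⟩ := eventually_atTop.1 (hgb.and (hlin.and (eventually_gt_atTop 0)))
    refine ⟨a, 16 * B / A ^ 2, (ha a le_rfl).2.2, fun s hs => ?_⟩
    obtain ⟨h1, h2, h3⟩ := ha s hs
    rw [Real.norm_eq_abs, Real.rpow_neg h3.le, Real.rpow_two, ← div_eq_mul_inv, div_div,
      le_div_iff₀ (by positivity)]
    rw [abs_mul, abs_of_nonneg (sq_nonneg _)] at h1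
    have h4 : (A / 4 * s) ^ 2 ≤ w s ^ 2 := by
      apply pow_le_pow_left₀ (by positivity) h2
    have h5 := mul_le_mul_of_nonneg_right h4 (abs_nonneg (D s))
    nlinarith
  obtain ⟨a, C, ha0, haC⟩ := hDb
  have hDc : Continuous D := by fun_prop
  have hint : IntegrableOn D (Ioi a) := by
    refine Integrable.mono' ((integrableOn_Ioi_rpow_of_lt (by norm_num : (-2 : ℝ) < -1) ha0).const_mul C)
      hDc.aestronglyMeasurable ?_
    filter_upwards [ae_restrict_mem measurableSet_Ioi] with s hs
    exact haC s (le_of_lt hs)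
  have hyK := tendsto_limUnder_of_hasDerivAt_of_integrableOn_Ioi (fun s _ => hyd s) hint
  set K := limUnder atTop y with hK
  refine ⟨K, ?_⟩
  have hws : Tendsto (fun s => w s / s) atTop (𝓝 A) := by
    have h1 : Tendsto (fun s => y s / s) atTop (𝓝 0) := hyK.div_atTop tendsto_id
    have h2 := h1.const_add A
    rw [add_zero] at h2
    refine h2.congr' ?_
    filter_upwards [eventually_gt_atTop 0] with s hs
    simp only [hy]
    field_simp
    ring
  have hDs : Tendsto (fun s => D s / (-(s ^ 2)⁻¹)) atTop (𝓝 ((q - 1) / c)) := by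
    have h1 := (hg.div (hws.pow 2) (by positivity)).neg
    have h2 : -((1 - q) * A ^ 2 / c / A ^ 2) = (q - 1) / c := by
      field_simp
      ring
    rw [h2] at h1
    refine h1.congr' ?_
    filter_upwards [eventually_gt_atTop 0] with s hs
    have := (hw s).ne'
    simp only [Pi.div_apply]
    field_simp
  -- The `0/0` rule compares `y - K` with `1 / s`, turning the limit of `s² D` into the coefficient
  -- of `1 / s`, with the sign reversed.
  have hlh := HasDerivAt.lhopital_zero_atTop (f := fun s => y s - K) (f' := D)
    (g := fun s : ℝ => s⁻¹) (g' := fun s => -(s ^ 2)⁻¹) (l := 𝓝 ((q - 1) / c))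
    (Eventually.of_forall fun s => (hyd s).sub_const K)
    (by
      filter_upwards [eventually_gt_atTop 0] with s hs
      exact hasDerivAt_inv hs.ne')
    (by
      filter_upwards [eventually_gt_atTop 0] with s hs
      exact neg_ne_zero.2 (inv_ne_zero (by positivity)))
    (by simpa using hyK.sub_const K) tendsto_inv_atTop_zero hDs
  refine hlh.congr fun s => ?_
  simp only [hy, div_inv_eq_mul]
  ring

end ScaledSystem

/-! ### Global solvability of retarded equations -/

lemma abs_integral_le_exp_of_nonneg {F : ℝ → ℝ} {a K : ℝ} (hK : 0 < K)
    (hF : ∀ τ, |F τ| ≤ a * Real.exp (K * |τ|)) {t : ℝ} (ht : 0 ≤ t) :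
    |∫ τ in (0 : ℝ)..t, F τ| ≤ a / K * (Real.exp (K * t) - 1) := by
  have hc : Continuous fun τ : ℝ => a * Real.exp (K * τ) := by fun_prop
  have h := intervalIntegral.norm_integral_le_of_norm_le (μ := volume) (f := F) ht
    (g := fun τ => a * Real.exp (K * τ))
    (Eventually.of_forall fun τ hτ => by
      have := hF τ
      rwa [abs_of_pos hτ.1] at this) (hc.intervalIntegrable _ _)
  rw [Real.norm_eq_abs] at h
  refine h.trans (le_of_eq ?_)
  rw [intervalIntegral.integral_const_mul, intervalIntegral.integral_comp_mul_left _ hK.ne',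
    integral_exp, mul_zero, Real.exp_zero, smul_eq_mul]
  ring

/-- Integration against the weight `exp (K |τ|)` gains a factor `1 / K`. This is the source of the
contraction below. -/
lemma abs_integral_le_exp {F : ℝ → ℝ} {a K : ℝ} (hK : 0 < K) (ha : 0 ≤ a)
    (hF : ∀ τ, |F τ| ≤ a * Real.exp (K * |τ|)) (t : ℝ) :
    |∫ τ in (0 : ℝ)..t, F τ| ≤ a / K * Real.exp (K * |t|) := by
  have hb : ∀ x : ℝ, a / K * (Real.exp x - 1) ≤ a / K * Real.exp x := fun x =>
    mul_le_mul_of_nonneg_left (by linarith) (by positivity)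
  rcases le_total 0 t with ht | ht
  · rw [abs_of_nonneg ht]
    exact (abs_integral_le_exp_of_nonneg hK hF ht).trans (hb _)
  · have h := abs_integral_le_exp_of_nonneg (F := fun τ => F (-τ)) hK
      (fun τ => by simpa using hF (-τ)) (neg_nonneg.2 ht)
    rw [intervalIntegral.integral_comp_neg, neg_neg, neg_zero, intervalIntegral.integral_symm,
      abs_neg] at h
    rw [abs_of_nonpos ht]
    exact h.trans (hb _)

/-- Global solvability of a retarded functional differential equation whose right-hand side is
Lipschitz for the supremum over the past. -/
lemma exists_hasDerivAt_of_retarded_lipschitz (Ψ : (ℝ → ℝ) → ℝ → ℝ)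
    (hcont : ∀ f, Continuous f → Continuous (Ψ f)) (h0 : ∀ t, Ψ (fun _ => 0) t = 0)
    {C : ℝ} (hC : 0 < C)
    (hlip : ∀ f g, Continuous f → Continuous g → ∀ t M,
      (∀ s, |s| ≤ |t| → |f s - g s| ≤ M) → |Ψ f t - Ψ g t| ≤ C * M) (L : ℝ) :
    ∃ f : ℝ → ℝ, f 0 = L ∧ ∀ t, HasDerivAt f (Ψ f t) t := by
  -- The unknown is written as `E b` with `b` bounded. Since `E` increases with `|t|`, the supremum
  -- over the past costs nothing, and the rate `2 C` turns the Lipschitz constant `C` into the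
  -- contraction factor `1/2` on the whole line at once.
  set E : ℝ → ℝ := fun t => Real.exp (2 * C * |t|) with hE
  have hEc : Continuous E := by fun_prop
  have hE0 : ∀ t, 0 < E t := fun t => Real.exp_pos _
  have hE1 : ∀ t, 1 ≤ E t := fun t => Real.one_le_exp (by positivity)
  have hEm : ∀ s t, |s| ≤ |t| → E s ≤ E t := fun s t h => Real.exp_le_exp.2 (by gcongr)
  have hK : 0 < 2 * C := by linarith
  have hest : ∀ f g, Continuous f → Continuous g → ∀ d, 0 ≤ d → (∀ s, |f s - g s| ≤ E s * d) →
      ∀ t, |∫ τ in (0 : ℝ)..t, (Ψ f τ - Ψ g τ)| ≤ d / 2 * E t := by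
    intro f g hf hg d hd hfg t
    have := abs_integral_le_exp (F := fun τ => Ψ f τ - Ψ g τ) (a := C * d) hK (by positivity)
      (fun τ => by
        have := hlip f g hf hg τ (E τ * d) fun s hs =>
          (hfg s).trans (mul_le_mul_of_nonneg_right (hEm s τ hs) hd)
        refine this.trans (le_of_eq ?_)
        simp only [hE]
        ring) t
    refine this.trans (le_of_eq ?_)
    simp only [hE]
    field_simp
  have hlc : ∀ b : BoundedContinuousFunction ℝ ℝ, Continuous fun t => E t * b t := fun b => by
    fun_prop
  have hic : ∀ f, Continuous f → Continuous fun t => ∫ τ in (0 : ℝ)..t, Ψ f τ := fun f hf =>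
    intervalIntegral.continuous_primitive (fun a b => (hcont f hf).intervalIntegrable a b) 0
  have hTc : ∀ b : BoundedContinuousFunction ℝ ℝ,
      Continuous fun t => (L + ∫ τ in (0 : ℝ)..t, Ψ (fun s => E s * b s) τ) / E t := fun b =>
    (continuous_const.add (hic _ (hlc b))).div hEc fun t => (hE0 t).ne'
  have hTb : ∀ b : BoundedContinuousFunction ℝ ℝ, ∀ t,
      ‖(L + ∫ τ in (0 : ℝ)..t, Ψ (fun s => E s * b s) τ) / E t‖ ≤ |L| + ‖b‖ / 2 := by
    intro b t
    have h := hest (fun s => E s * b s) (fun _ => 0) (hlc b) continuous_const ‖b‖ (norm_nonneg b)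
      (fun s => by
        rw [sub_zero, abs_mul, abs_of_pos (hE0 s)]
        exact mul_le_mul_of_nonneg_left (b.norm_coe_le_norm s) (hE0 s).le) t
    simp only [h0, sub_zero] at h
    rw [Real.norm_eq_abs, abs_div, abs_of_pos (hE0 t), div_le_iff₀ (hE0 t)]
    have h2 := abs_add_le L (∫ τ in (0 : ℝ)..t, Ψ (fun s => E s * b s) τ)
    have h3 : |L| ≤ |L| * E t := le_mul_of_one_le_right (abs_nonneg L) (hE1 t)
    rw [add_mul]
    linarith
  set T : BoundedContinuousFunction ℝ ℝ → BoundedContinuousFunction ℝ ℝ := fun b =>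
    BoundedContinuousFunction.ofNormedAddCommGroup _ (hTc b) _ (hTb b) with hT
  have hTapp : ∀ b t, T b t = (L + ∫ τ in (0 : ℝ)..t, Ψ (fun s => E s * b s) τ) / E t :=
    fun b t => rfl
  have hcontr : ContractingWith (1 / 2) T := by
    refine ⟨by norm_num, LipschitzWith.of_dist_le_mul fun b₁ b₂ => ?_⟩
    rw [BoundedContinuousFunction.dist_le (by positivity)]
    intro t
    have h := hest (fun s => E s * b₁ s) (fun s => E s * b₂ s) (hlc b₁) (hlc b₂) (dist b₁ b₂)
      dist_nonneg (fun s => by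
        rw [← mul_sub, abs_mul, abs_of_pos (hE0 s)]
        exact mul_le_mul_of_nonneg_left
          ((Real.dist_eq _ _).symm.trans_le (BoundedContinuousFunction.dist_coe_le_dist s))
          (hE0 s).le) t
    rw [intervalIntegral.integral_sub ((hcont _ (hlc b₁)).intervalIntegrable _ _)
      ((hcont _ (hlc b₂)).intervalIntegrable _ _)] at h
    rw [hTapp, hTapp, Real.dist_eq, ← sub_div, add_sub_add_left_eq_sub, abs_div,
      abs_of_pos (hE0 t), div_le_iff₀ (hE0 t)]
    refine h.trans (le_of_eq ?_)
    push_cast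
    ring
  set b := ContractingWith.fixedPoint T hcontr with hb
  have hfix : T b = b := hcontr.fixedPoint_isFixedPt
  have hf : ∀ t, E t * b t = L + ∫ τ in (0 : ℝ)..t, Ψ (fun s => E s * b s) τ := by
    intro t
    have := hTapp b t
    rw [hfix] at this
    rw [this, mul_div_cancel₀ _ (hE0 t).ne']
  refine ⟨fun t => E t * b t, (hf 0).trans (by
    rw [intervalIntegral.integral_same, add_zero]),
    fun t => ?_⟩
  have hcΨ := hcont _ (hlc b)
  have hd := (intervalIntegral.integral_hasDerivAt_right (hcΨ.intervalIntegrable 0 t)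
    hcΨ.stronglyMeasurable.stronglyMeasurableAtFilter hcΨ.continuousAt).const_add L
  exact hd.congr_of_eventuallyEq (Eventually.of_forall hf)

/-! ### The truncated power -/

/-- The `C¹`, globally Lipschitz function that agrees with `x ^ p` on `[0, 1]`, vanishes on the
negative axis and is affine on `[1, ∞)`. -/
noncomputable def truncPow (p x : ℝ) : ℝ := ∫ y in (0 : ℝ)..x, p * (max 0 (min y 1)) ^ (p - 1)

section TruncPow

variable {p : ℝ}

lemma continuous_truncPow_deriv (hp : 1 < p) :
    Continuous fun y : ℝ => p * (max 0 (min y 1)) ^ (p - 1) := by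
  have : Continuous fun y : ℝ => max 0 (min y 1) := by fun_prop
  exact continuous_const.mul (this.rpow_const fun _ => Or.inr (by linarith))

lemma hasDerivAt_truncPow (hp : 1 < p) (x : ℝ) :
    HasDerivAt (truncPow p) (p * (max 0 (min x 1)) ^ (p - 1)) x :=
  intervalIntegral.integral_hasDerivAt_right ((continuous_truncPow_deriv hp).intervalIntegrable _ _)
    (continuous_truncPow_deriv hp).stronglyMeasurable.stronglyMeasurableAtFilter
    (continuous_truncPow_deriv hp).continuousAt

lemma truncPow_zero : truncPow p 0 = 0 := intervalIntegral.integral_same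

lemma truncPow_deriv_nonneg (hp : 1 < p) (x : ℝ) : 0 ≤ p * (max 0 (min x 1)) ^ (p - 1) :=
  mul_nonneg (by linarith) (Real.rpow_nonneg (le_max_left _ _) _)

lemma truncPow_deriv_le (hp : 1 < p) (x : ℝ) : p * (max 0 (min x 1)) ^ (p - 1) ≤ p := by
  have : (max 0 (min x 1)) ^ (p - 1) ≤ 1 :=
    Real.rpow_le_one (le_max_left _ _) (max_le zero_le_one (min_le_right _ _)) (by linarith)
  nlinarith

lemma abs_truncPow_sub_le (hp : 1 < p) (x y : ℝ) :
    |truncPow p x - truncPow p y| ≤ p * |x - y| := by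
  have := Convex.norm_image_sub_le_of_norm_hasDerivWithin_le (f := truncPow p)
    (f' := fun x => p * (max 0 (min x 1)) ^ (p - 1)) (C := p) (s := univ) (x := y) (y := x)
    (fun z _ => (hasDerivAt_truncPow hp z).hasDerivWithinAt)
    (fun z _ => by
      rw [Real.norm_eq_abs, abs_of_nonneg (truncPow_deriv_nonneg hp z)]
      exact truncPow_deriv_le hp z) convex_univ (mem_univ _) (mem_univ _)
  simpa using this

lemma truncPow_of_mem (hp : 1 < p) {x : ℝ} (h0 : 0 ≤ x) (h1 : x ≤ 1) : truncPow p x = x ^ p := by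
  have h : ∫ y in (0 : ℝ)..x, p * (max 0 (min y 1)) ^ (p - 1) = ∫ y in (0 : ℝ)..x, p * y ^ (p - 1) := by
    apply intervalIntegral.integral_congr
    intro y hy
    rw [uIcc_of_le h0] at hy
    simp only [min_eq_left (hy.2.trans h1), max_eq_right hy.1]
  rw [truncPow, h, intervalIntegral.integral_const_mul, integral_rpow (Or.inl (by linarith))]
  rw [sub_add_cancel, Real.zero_rpow (by linarith), sub_zero]
  field_simp

/-- What survives of the Euler identity for `x^p`: equality up to `x = 1`, and beyond it the
difference of the two sides is `p (p-1)(x-1)`. It is needed for every real `x`, because the profile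
is not yet known to stay in `[0, 1]`. -/
lemma truncPow_deriv_mul_le (hp : 1 < p) (x : ℝ) :
    p * (max 0 (min x 1)) ^ (p - 1) * x ≤ p * truncPow p x := by
  have hc := continuous_truncPow_deriv hp
  rcases le_total x 0 with hx | hx
  · have h1 : (max 0 (min x 1)) ^ (p - 1) = 0 := by
      rw [min_eq_left (hx.trans zero_le_one), max_eq_left hx, Real.zero_rpow (by linarith)]
    have h2 : truncPow p x = 0 := by
      have h : ∫ y in (0 : ℝ)..x, p * (max 0 (min y 1)) ^ (p - 1) = ∫ y in (0 : ℝ)..x, (0 : ℝ) := by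
        apply intervalIntegral.integral_congr
        intro y hy
        rw [uIcc_of_ge hx] at hy
        simp only [min_eq_left (hy.2.trans zero_le_one), max_eq_left hy.2]
        rw [Real.zero_rpow (by linarith), mul_zero]
      rw [truncPow, h, intervalIntegral.integral_zero]
    rw [h1, h2]
    simp
  rcases le_total x 1 with hx1 | hx1
  · rw [truncPow_of_mem hp hx hx1, min_eq_left hx1, max_eq_right hx, mul_assoc]
    rcases hx.eq_or_lt with h | h
    · rw [← h, mul_zero, mul_zero, Real.zero_rpow (by linarith), mul_zero]
    · rw [Real.rpow_sub_one h.ne', div_mul_cancel₀ _ h.ne']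
  · have h : ∫ y in (1 : ℝ)..x, p * (max 0 (min y 1)) ^ (p - 1) = ∫ y in (1 : ℝ)..x, p := by
      apply intervalIntegral.integral_congr
      intro y hy
      rw [uIcc_of_le hx1] at hy
      simp only [min_eq_right hy.1, max_eq_right zero_le_one, Real.one_rpow, mul_one]
    have h2 : truncPow p x = truncPow p 1 + ∫ y in (1 : ℝ)..x, p * (max 0 (min y 1)) ^ (p - 1) :=
      (intervalIntegral.integral_add_adjacent_intervals (hc.intervalIntegrable _ _)
        (hc.intervalIntegrable _ _)).symm
    rw [h2, h, truncPow_of_mem hp zero_le_one le_rfl, Real.one_rpow, min_eq_right hx1,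
      max_eq_right zero_le_one, Real.one_rpow]
    simp only [intervalIntegral.integral_const, smul_eq_mul, mul_one]
    nlinarith [mul_nonneg (mul_nonneg (by linarith : (0 : ℝ) ≤ p) (by linarith : (0 : ℝ) ≤ p - 1))
      (by linarith : (0 : ℝ) ≤ x - 1)]

end TruncPow

/-! ### Construction of the radial profile -/

lemma hasDerivAt_integral_pow_mul_comp {G G' : ℝ → ℝ} (hG : ∀ t, HasDerivAt G (G' t) t)
    (hG' : Continuous G') (j : ℕ) (t : ℝ) :
    HasDerivAt (fun t => ∫ ρ in (0 : ℝ)..1, ρ ^ j * G (t * ρ ^ 2))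
      (∫ ρ in (0 : ℝ)..1, ρ ^ (j + 2) * G' (t * ρ ^ 2)) t := by
  have hGc : Continuous G := continuous_iff_continuousAt.2 fun s => (hG s).continuousAt
  obtain ⟨B, hB⟩ := (isCompact_Icc (a := -(|t| + 1)) (b := |t| + 1)).exists_bound_of_continuousOn
    hG'.continuousOn
  refine (intervalIntegral.hasDerivAt_integral_of_dominated_loc_of_deriv_le (μ := volume)
    (F := fun t ρ => ρ ^ j * G (t * ρ ^ 2)) (F' := fun t ρ => ρ ^ (j + 2) * G' (t * ρ ^ 2))
    (bound := fun _ => B)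
    (Metric.ball_mem_nhds t one_pos) ?_ ?_ ?_ ?_ ?_ ?_).2
  · exact Eventually.of_forall fun s =>
      Continuous.aestronglyMeasurable (by fun_prop)
  · exact Continuous.intervalIntegrable (by fun_prop) _ _
  · exact Continuous.aestronglyMeasurable (by fun_prop)
  · refine Eventually.of_forall fun ρ hρ s hs => ?_
    rw [uIoc_of_le zero_le_one] at hρ
    have h1 : |s| ≤ |t| + 1 := by
      have h2 := abs_sub_abs_le_abs_sub s t
      rw [Metric.mem_ball, Real.dist_eq] at hs
      linarith
    have hρ2 : ρ ^ 2 ≤ 1 := pow_le_one₀ hρ.1.le hρ.2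
    have h3 : |s * ρ ^ 2| ≤ |t| + 1 := by
      rw [abs_mul, abs_of_nonneg (sq_nonneg ρ)]
      exact (mul_le_of_le_one_right (abs_nonneg s) hρ2).trans h1
    have h4 := hB _ (abs_le.1 h3)
    rw [norm_mul, Real.norm_of_nonneg (pow_nonneg hρ.1.le _)]
    exact (mul_le_of_le_one_left (norm_nonneg _) (pow_le_one₀ hρ.1.le hρ.2)).trans h4
  · exact intervalIntegrable_const
  · refine Eventually.of_forall fun ρ _ s _ => ?_
    have h1 : HasDerivAt (fun s : ℝ => s * ρ ^ 2) (ρ ^ 2) s := by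
      simpa using (hasDerivAt_id s).mul_const (ρ ^ 2)
    exact (((hG (s * ρ ^ 2)).comp s h1).const_mul (ρ ^ j)).congr_deriv (by ring)

/-- Integrate the derivative of `ρ^n G(t ρ²)` over `[0, 1]`. This identity converts the integrated
form of the profile equation back into the differential one. -/
lemma two_mul_integral_pow_add {G G' : ℝ → ℝ} (hG : ∀ t, HasDerivAt G (G' t) t)
    (hG' : Continuous G') {n : ℕ} (hn : 1 ≤ n) (t : ℝ) :
    2 * t * (∫ ρ in (0 : ℝ)..1, ρ ^ (n - 1 + 2) * G' (t * ρ ^ 2))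
      + n * (∫ ρ in (0 : ℝ)..1, ρ ^ (n - 1) * G (t * ρ ^ 2)) = G t := by
  have hGc : Continuous G := continuous_iff_continuousAt.2 fun s => (hG s).continuousAt
  have hd : ∀ ρ : ℝ, HasDerivAt (fun ρ => ρ ^ n * G (t * ρ ^ 2))
      (2 * t * (ρ ^ (n - 1 + 2) * G' (t * ρ ^ 2)) + n * (ρ ^ (n - 1) * G (t * ρ ^ 2))) ρ := by
    intro ρ
    have h1 : HasDerivAt (fun ρ : ℝ => t * ρ ^ 2) (t * (2 * ρ)) ρ := by
      simpa using ((hasDerivAt_id ρ).pow 2).const_mul t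
    refine ((hasDerivAt_pow n ρ).mul ((hG (t * ρ ^ 2)).comp ρ h1)).congr_deriv ?_
    obtain ⟨j, rfl⟩ : ∃ j, n = j + 1 := ⟨n - 1, by omega⟩
    simp only [Nat.add_sub_cancel, Function.comp]
    ring
  have hi : Continuous fun ρ : ℝ => 2 * t * (ρ ^ (n - 1 + 2) * G' (t * ρ ^ 2))
      + n * (ρ ^ (n - 1) * G (t * ρ ^ 2)) := by fun_prop
  have h := intervalIntegral.integral_eq_sub_of_hasDerivAt (fun ρ _ => hd ρ)
    (hi.intervalIntegrable 0 1)
  rw [intervalIntegral.integral_add (Continuous.intervalIntegrable (by fun_prop) _ _)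
    (Continuous.intervalIntegrable (by fun_prop) _ _), intervalIntegral.integral_const_mul,
    intervalIntegral.integral_const_mul] at h
  rw [h]
  simp [show n ≠ 0 by omega]

/-- Global solutions of the radial equation with truncated nonlinearity. -/
lemma exists_truncated_profile {n : ℕ} (hn : 3 ≤ n) {k p : ℝ} (hk : 0 < k) (hp : 1 < p) :
    ∃ U U₁ U₂ : ℝ → ℝ, U 0 = 1 ∧ (∀ t, HasDerivAt U (U₁ t) t) ∧ (∀ t, HasDerivAt U₁ (U₂ t) t) ∧
      Continuous U₂ ∧ ∀ t, t * U₂ t + n / 2 * U₁ t =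
        -k * (2 * t * (p * (max 0 (min (U t) 1)) ^ (p - 1) * U₁ t)
          + (n + 2) / 2 * truncPow p (U t)) := by
  have hn' : (3 : ℝ) ≤ n := by exact_mod_cast hn
  have hφc : Continuous (truncPow p) :=
    continuous_iff_continuousAt.2 fun s => (hasDerivAt_truncPow hp s).continuousAt
  -- The equation integrated once from the origin, with the integral rescaled to `[0, 1]`: the
  -- singular factor at `t = 0` disappears, and only values at times `t ρ²` enter. The Lipschitz
  -- constant is `k (2 p + (n-2) p) = k n p`.
  set Ψ : (ℝ → ℝ) → ℝ → ℝ := fun f t =>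
    -k * (2 * truncPow p (f t)
      - (n - 2) * ∫ ρ in (0 : ℝ)..1, ρ ^ (n - 1) * truncPow p (f (t * ρ ^ 2))) with hΨ
  have hJc : ∀ G : ℝ → ℝ, Continuous G → ∀ j : ℕ,
      Continuous fun t : ℝ => ∫ ρ in (0 : ℝ)..1, ρ ^ j * G (t * ρ ^ 2) := by
    intro G hG j
    apply intervalIntegral.continuous_parametric_intervalIntegral_of_continuous'
    simp only [Function.uncurry_def]
    fun_prop
  have hΨc : ∀ f, Continuous f → Continuous (Ψ f) := by
    intro f hf
    have := hJc (fun s => truncPow p (f s)) (hφc.comp hf) (n - 1)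
    simp only [hΨ]
    fun_prop
  obtain ⟨U, hU0, hUd⟩ := exists_hasDerivAt_of_retarded_lipschitz Ψ hΨc
    (by intro t; simp [hΨ, truncPow_zero]) (C := k * (n * p)) (by positivity) (by
      intro f g hf hg t M hM
      have hM0 : 0 ≤ M := (abs_nonneg _).trans (hM t le_rfl)
      have h1 : |truncPow p (f t) - truncPow p (g t)| ≤ p * M :=
        (abs_truncPow_sub_le hp _ _).trans
          (mul_le_mul_of_nonneg_left (hM t le_rfl) (by linarith))
      have h2 : |(∫ ρ in (0 : ℝ)..1, ρ ^ (n - 1) * truncPow p (f (t * ρ ^ 2)))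
          - ∫ ρ in (0 : ℝ)..1, ρ ^ (n - 1) * truncPow p (g (t * ρ ^ 2))| ≤ p * M := by
        rw [← intervalIntegral.integral_sub (Continuous.intervalIntegrable (by fun_prop) _ _)
          (Continuous.intervalIntegrable (by fun_prop) _ _)]
        have := intervalIntegral.norm_integral_le_of_norm_le_const (a := (0 : ℝ)) (b := 1)
          (f := fun ρ : ℝ => ρ ^ (n - 1) * truncPow p (f (t * ρ ^ 2))
            - ρ ^ (n - 1) * truncPow p (g (t * ρ ^ 2))) (C := p * M) (by
            intro ρ hρ
            rw [uIoc_of_le zero_le_one] at hρ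
            have hρ2 : ρ ^ 2 ≤ 1 := pow_le_one₀ hρ.1.le hρ.2
            have h3 : |t * ρ ^ 2| ≤ |t| := by
              rw [abs_mul, abs_of_nonneg (sq_nonneg ρ)]
              exact mul_le_of_le_one_right (abs_nonneg t) hρ2
            rw [← mul_sub, norm_mul, Real.norm_of_nonneg (pow_nonneg hρ.1.le _)]
            exact (mul_le_of_le_one_left (norm_nonneg _) (pow_le_one₀ hρ.1.le hρ.2)).trans
              ((abs_truncPow_sub_le hp _ _).trans
                (mul_le_mul_of_nonneg_left (hM _ h3) (by linarith))))
        simpa using this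
      have h4 : Ψ f t - Ψ g t = -k * (2 * (truncPow p (f t) - truncPow p (g t))
          - (n - 2) * ((∫ ρ in (0 : ℝ)..1, ρ ^ (n - 1) * truncPow p (f (t * ρ ^ 2)))
          - ∫ ρ in (0 : ℝ)..1, ρ ^ (n - 1) * truncPow p (g (t * ρ ^ 2)))) := by
        simp only [hΨ]
        ring
      rw [h4, abs_mul, abs_neg, abs_of_pos hk, mul_assoc]
      refine mul_le_mul_of_nonneg_left ?_ hk.le
      refine (abs_sub _ _).trans ?_
      rw [abs_mul, abs_mul, abs_of_pos (by norm_num : (0 : ℝ) < 2),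
        abs_of_nonneg (by linarith : (0 : ℝ) ≤ n - 2)]
      nlinarith [mul_le_mul_of_nonneg_left h2 (by linarith : (0 : ℝ) ≤ n - 2)]) 1
  have hUc : Continuous U := continuous_iff_continuousAt.2 fun s => (hUd s).continuousAt
  have hU1c : Continuous (Ψ U) := hΨc U hUc
  set ψ : ℝ → ℝ := fun t => p * (max 0 (min (U t) 1)) ^ (p - 1) * Ψ U t with hψ
  have hψc : Continuous ψ := ((continuous_truncPow_deriv hp).comp hUc).mul hU1c
  have hGd : ∀ t, HasDerivAt (fun t => truncPow p (U t)) (ψ t) t := fun t =>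
    (hasDerivAt_truncPow hp (U t)).comp t (hUd t)
  refine ⟨U, Ψ U, fun t => -k * (2 * ψ t
    - (n - 2) * ∫ ρ in (0 : ℝ)..1, ρ ^ (n - 1 + 2) * ψ (t * ρ ^ 2)), hU0, hUd, fun t => ?_, ?_,
    fun t => ?_⟩
  · exact (((hGd t).const_mul 2).sub
      ((hasDerivAt_integral_pow_mul_comp hGd hψc (n - 1) t).const_mul ((n : ℝ) - 2))).const_mul (-k)
  · have := hJc ψ hψc (n - 1 + 2)
    fun_prop
  · have h := two_mul_integral_pow_add hGd hψc (show 1 ≤ n by omega) t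
    have h2 : p * (max 0 (min (U t) 1)) ^ (p - 1) * Ψ U t = ψ t := rfl
    rw [h2, ← h]
    simp only [hΨ]
    rw [← h]
    ring

/-- While `a U + 2 t U'` stays positive, the profile decreases. -/
lemma profile_deriv_nonpos {n : ℕ} (hn : 3 ≤ n) {k p : ℝ} (hk : 0 < k) (hp : 1 < p)
    (hpn : ((n : ℝ) - 2) * p = n + 2) {U U₁ U₂ : ℝ → ℝ}
    (hU₁ : ∀ t, HasDerivAt U₁ (U₂ t) t)
    (hode : ∀ t, t * U₂ t + n / 2 * U₁ t =
        -k * (2 * t * (p * (max 0 (min (U t) 1)) ^ (p - 1) * U₁ t)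
          + (n + 2) / 2 * truncPow p (U t))) {T : ℝ}
    (hY : ∀ t, 0 ≤ t → t < T → 0 < ((n : ℝ) - 2) / 2 * U t + 2 * t * U₁ t) {t : ℝ}
    (ht : 0 < t) (htT : t ≤ T) : U₁ t ≤ 0 := by
  have hn' : (3 : ℝ) ≤ n := by exact_mod_cast hn
  -- Up to a constant this is the radial flux `r^(n-1) dU/dr`; it vanishes at the origin, so it
  -- suffices that it decreases.
  set V : ℝ → ℝ := fun r => r ^ n * U₁ (r ^ 2) with hV
  have hVd : ∀ r, HasDerivAt V (2 * r ^ (n - 1) * (r ^ 2 * U₂ (r ^ 2) + n / 2 * U₁ (r ^ 2))) r := by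
    intro r
    have h1 : HasDerivAt (fun r : ℝ => r ^ 2) (2 * r) r := by
      simpa using hasDerivAt_pow 2 r
    refine ((hasDerivAt_pow n r).mul ((hU₁ (r ^ 2)).comp r h1)).congr_deriv ?_
    obtain ⟨j, rfl⟩ : ∃ j, n = j + 1 := ⟨n - 1, by omega⟩
    simp only [Nat.add_sub_cancel, Function.comp]
    ring
  have hanti : AntitoneOn V (Icc 0 (Real.sqrt T)) := by
    apply antitoneOn_of_deriv_nonpos (convex_Icc _ _)
    · exact fun r _ => (hVd r).continuousAt.continuousWithinAt
    · exact fun r _ => (hVd r).differentiableAt.differentiableWithinAt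
    · intro r hr
      rw [interior_Icc] at hr
      have hr2 : r ^ 2 < T := (Real.lt_sqrt hr.1.le).1 hr.2
      rw [(hVd r).deriv, hode]
      have h1 := hY (r ^ 2) (sq_nonneg r) hr2
      have h2 := truncPow_deriv_nonneg hp (U (r ^ 2))
      have h3 := truncPow_deriv_mul_le hp (U (r ^ 2))
      generalize p * (max 0 (min (U (r ^ 2)) 1)) ^ (p - 1) = F at h2 h3 ⊢
      -- With `(n+2)/2 = p (n-2)/2`, the inequality `truncPow_deriv_mul_le` bounds the left side
      -- below by `F` times the positive quantity in `hY`.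
      have h4 : 0 ≤ 2 * r ^ 2 * (F * U₁ (r ^ 2)) + (n + 2) / 2 * truncPow p (U (r ^ 2)) := by
        have h5 := mul_nonneg h2 h1.le
        have h6 := mul_le_mul_of_nonneg_left h3 (by linarith : (0 : ℝ) ≤ (n - 2) / 2)
        rw [← hpn]
        linarith
      have h7 : 0 ≤ r ^ (n - 1) := pow_nonneg hr.1.le _
      have h8 := mul_nonneg hk.le h4
      have h9 := mul_nonneg h7 h8
      linarith
  have hst : Real.sqrt t ≤ Real.sqrt T := Real.sqrt_le_sqrt htT
  have h := hanti (left_mem_Icc.2 (Real.sqrt_nonneg T)) ⟨Real.sqrt_nonneg t, hst⟩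
    (Real.sqrt_nonneg t)
  simp only [hV, Real.sq_sqrt ht.le, zero_pow (show n ≠ 0 by omega), zero_mul] at h
  have h2 : 0 < Real.sqrt t ^ n := pow_pos (Real.sqrt_pos.2 ht) n
  by_contra hneg
  push Not at hneg
  exact absurd (mul_pos h2 hneg) (not_lt.2 h)

lemma nonpos_of_hasDerivAt_of_pos_left {Y : ℝ → ℝ} {y t₀ t₁ : ℝ} (h : HasDerivAt Y y t₁)
    (h01 : t₀ < t₁) (h1 : Y t₁ = 0) (hpos : ∀ t, t₀ < t → t < t₁ → 0 < Y t) : y ≤ 0 := by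
  have h2 := (hasDerivWithinAt_iff_tendsto_slope' (show t₁ ∉ Iio t₁ by simp)).1
    h.hasDerivWithinAt
  refine le_of_tendsto h2 ?_
  filter_upwards [Ioo_mem_nhdsLT h01] with t ht
  rw [slope_def_field, h1, sub_zero]
  exact div_nonpos_of_nonneg_of_nonpos (hpos t ht.1 ht.2).le (by linarith [ht.2])

/-- A radial profile: a positive decreasing `C²` solution of the equation in the variable
`t = r²`, for which `r ^ ((n - 2) / 2) U` increases. -/
lemma exists_radial_profile {n : ℕ} (hn : 3 ≤ n) {k p : ℝ} (hk : 0 < k)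
    (hpn : ((n : ℝ) - 2) * p = n + 2) :
    ∃ U U₁ U₂ : ℝ → ℝ, U 0 = 1 ∧ (∀ t, HasDerivAt U (U₁ t) t) ∧ (∀ t, HasDerivAt U₁ (U₂ t) t) ∧
      Continuous U₂ ∧ (∀ t, 0 ≤ t → 0 < U t) ∧ (∀ t, 0 ≤ t → U₁ t ≤ 0) ∧
      (∀ t, 0 ≤ t → 0 < ((n : ℝ) - 2) / 2 * U t + 2 * t * U₁ t) ∧
      ∀ t, 0 ≤ t → t * U₂ t + n / 2 * U₁ t =
        -k * (2 * t * (p * U t ^ (p - 1) * U₁ t) + (n + 2) / 2 * U t ^ p) := by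
  have hn' : (3 : ℝ) ≤ n := by exact_mod_cast hn
  have hp : 1 < p := by nlinarith
  obtain ⟨U, U₁, U₂, hU0, hU, hU₁, hU₂, hode⟩ := exists_truncated_profile hn hk hp
  set a : ℝ := ((n : ℝ) - 2) / 2 with ha
  have ha0 : 0 < a := by rw [ha]; linarith
  set Y : ℝ → ℝ := fun t => a * U t + 2 * t * U₁ t with hYdef
  have hYd : ∀ t, HasDerivAt Y (a * U₁ t + (2 * U₁ t + 2 * t * U₂ t)) t := by
    intro t
    have h1 : HasDerivAt (fun t : ℝ => 2 * t) 2 t := by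
      simpa using (hasDerivAt_id t).const_mul (2 : ℝ)
    exact ((hU t).const_mul a).add (h1.mul (hU₁ t))
  have hYc : Continuous Y := continuous_iff_continuousAt.2 fun s => (hYd s).continuousAt
  have hU1le : ∀ T, (∀ t, 0 ≤ t → t < T → 0 < Y t) → ∀ t, 0 ≤ t → t ≤ T → U t ≤ 1 := by
    intro T hT t ht htT
    have hm : AntitoneOn U (Icc 0 T) := by
      apply antitoneOn_of_deriv_nonpos (convex_Icc _ _)
      · exact fun r _ => (hU r).continuousAt.continuousWithinAt
      · exact fun r _ => (hU r).differentiableAt.differentiableWithinAt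
      · intro r hr
        rw [interior_Icc] at hr
        rw [(hU r).deriv]
        exact profile_deriv_nonpos hn hk hp hpn hU₁ hode hT hr.1 hr.2.le
    have := hm (left_mem_Icc.2 (ht.trans htT)) ⟨ht, htT⟩ ht
    rwa [hU0] at this
  -- At a first zero `t₁` the derivative of `Y` must be nonpositive, while the equation makes it
  -- equal to `-a U'(t₁) > 0`.
  have hYpos : ∀ t, 0 ≤ t → 0 < Y t := by
    by_contra hcon
    push Not at hcon
    set S : Set ℝ := {t | 0 ≤ t ∧ Y t ≤ 0} with hS
    have hSne : S.Nonempty := hcon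
    have hSc : IsClosed S := (isClosed_le continuous_const continuous_id).inter
      (isClosed_le hYc continuous_const)
    have hSb : BddBelow S := ⟨0, fun t ht => ht.1⟩
    set t₁ := sInf S with ht₁
    have ht₁S : t₁ ∈ S := hSc.csInf_mem hSne hSb
    have hY0 : Y 0 = a := by simp [hYdef, hU0]
    have ht₁0 : 0 < t₁ := by
      rcases ht₁S.1.eq_or_lt with h | h
      · have := ht₁S.2
        rw [← h, hY0] at this
        linarith
      · exact h
    have hbef : ∀ t, 0 ≤ t → t < t₁ → 0 < Y t := by
      intro t ht htt
      by_contra hneg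
      exact absurd (csInf_le hSb (show t ∈ S from ⟨ht, not_lt.1 hneg⟩)) (not_le.2 htt)
    have hYt₁ : Y t₁ = 0 := by
      refine le_antisymm ht₁S.2 ?_
      have h1 : Tendsto Y (𝓝[<] t₁) (𝓝 (Y t₁)) := hYc.continuousAt.mono_left nhdsWithin_le_nhds
      refine ge_of_tendsto h1 ?_
      filter_upwards [Ioo_mem_nhdsLT ht₁0] with t ht
      exact (hbef t ht.1.le ht.2).le
    have hpos : ∀ t, 0 < t → t < t₁ → 0 < U t := by
      intro t ht htt
      have h1 := profile_deriv_nonpos hn hk hp hpn hU₁ hode hbef ht htt.le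
      have h2 : 0 < a * U t + 2 * t * U₁ t := hbef t ht.le htt
      have h3 : t * U₁ t ≤ 0 := mul_nonpos_of_nonneg_of_nonpos ht.le h1
      by_contra hneg
      push Not at hneg
      have := mul_nonpos_of_nonneg_of_nonpos ha0.le hneg
      linarith
    have hUt₁ : 0 < U t₁ := by
      -- Positivity of `Y` before `t₁` means that `t^(a/2) U` increases there, so `U` cannot drop to
      -- zero at `t₁`.
      have hd : ∀ t, 0 < t → HasDerivAt (fun t => t ^ (a / 2) * U t)
          (t ^ (a / 2 - 1) * Y t / 2) t := by
        intro t ht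
        refine ((Real.hasDerivAt_rpow_const (p := a / 2) (Or.inl ht.ne')).mul
          (hU t)).congr_deriv ?_
        rw [Real.rpow_sub_one ht.ne']
        simp only [hYdef]
        field_simp
      have hm : MonotoneOn (fun t => t ^ (a / 2) * U t) (Icc (t₁ / 2) t₁) := by
        apply monotoneOn_of_deriv_nonneg (convex_Icc _ _)
        · exact fun r hr => (hd r (by linarith [hr.1])).continuousAt.continuousWithinAt
        · intro r hr
          rw [interior_Icc] at hr
          exact (hd r (by linarith [hr.1])).differentiableAt.differentiableWithinAt
        · intro r hr
          rw [interior_Icc] at hr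
          have hr0 : 0 < r := by linarith [hr.1]
          rw [(hd r hr0).deriv]
          have := mul_pos (Real.rpow_pos_of_pos hr0 (a / 2 - 1)) (hbef r hr0.le hr.2)
          linarith
      have h1 := hm (left_mem_Icc.2 (by linarith)) (right_mem_Icc.2 (by linarith))
        (by linarith : t₁ / 2 ≤ t₁)
      have h2 : 0 < (t₁ / 2) ^ (a / 2) * U (t₁ / 2) :=
        mul_pos (Real.rpow_pos_of_pos (by linarith) _) (hpos _ (by linarith) (by linarith))
      have h3 : 0 < t₁ ^ (a / 2) * U t₁ := h2.trans_le h1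
      exact (pos_iff_pos_of_mul_pos h3).1 (Real.rpow_pos_of_pos ht₁0 _)
    have hUt₁' : U t₁ ≤ 1 := hU1le t₁ hbef t₁ ht₁0.le le_rfl
    have hder := nonpos_of_hasDerivAt_of_pos_left (hYd t₁) ht₁0 hYt₁ fun t h0 h1 => hbef t h0.le h1
    have hφ := truncPow_of_mem hp hUt₁.le hUt₁'
    have hode₁ := hode t₁
    rw [hφ, min_eq_left hUt₁', max_eq_right hUt₁.le, Real.rpow_sub_one hUt₁.ne'] at hode₁
    have hz : 2 * t₁ * U₁ t₁ = -(a * U t₁) := by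
      simp only [hYdef] at hYt₁
      linarith
    -- At a zero of `Y`, `U` has the logarithmic slope of `t^(-a/2)`; since `p a = (n+2)/2`, the
    -- nonlinear side of the equation vanishes and the linear part `t U'' + (n/2) U' = 0` remains.
    have hzero : 2 * t₁ * (p * (U t₁ ^ p / U t₁) * U₁ t₁) + (n + 2) / 2 * U t₁ ^ p = 0 := by
      have : 2 * t₁ * (p * (U t₁ ^ p / U t₁) * U₁ t₁)
          = p * (U t₁ ^ p / U t₁) * (2 * t₁ * U₁ t₁) := by ring
      rw [this, hz, ← hpn, ha]
      field_simp
      ring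
    rw [hzero, mul_zero] at hode₁
    have hneg : U₁ t₁ < 0 := by
      by_contra hcon
      push Not at hcon
      have h1 := mul_nonneg ht₁0.le hcon
      have h2 := mul_pos ha0 hUt₁
      linarith
    have h3 : a * U₁ t₁ + (2 * U₁ t₁ + 2 * t₁ * U₂ t₁) = -a * U₁ t₁ := by
      have : n = 2 * a + 2 := by rw [ha]; ring
      rw [this] at hode₁
      linarith
    rw [h3] at hder
    nlinarith
  have hU1neg : ∀ t, 0 < t → U₁ t ≤ 0 := fun t ht =>
    profile_deriv_nonpos hn hk hp hpn hU₁ hode (T := t) (fun s hs _ => hYpos s hs) ht le_rfl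
  have hU1neg' : ∀ t, 0 ≤ t → U₁ t ≤ 0 := by
    intro t ht
    rcases ht.eq_or_lt with h | h
    · have h0 := hode 0
      rw [hU0, truncPow_of_mem hp zero_le_one le_rfl, Real.one_rpow] at h0
      rw [← h]
      simp only [zero_mul, mul_zero, zero_add, mul_one] at h0
      nlinarith [mul_pos hk (by linarith : (0 : ℝ) < (n + 2) / 2)]
    · exact hU1neg t h
  have hUpos : ∀ t, 0 ≤ t → 0 < U t := by
    intro t ht
    have h2 : 0 < a * U t + 2 * t * U₁ t := hYpos t ht
    have h3 : t * U₁ t ≤ 0 := mul_nonpos_of_nonneg_of_nonpos ht (hU1neg' t ht)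
    by_contra hneg
    push Not at hneg
    have := mul_nonpos_of_nonneg_of_nonpos ha0.le hneg
    linarith
  refine ⟨U, U₁, U₂, hU0, hU, hU₁, hU₂, hUpos, hU1neg', hYpos, fun t ht => ?_⟩
  have h1 := hU1le t (fun s hs _ => hYpos s hs) t ht le_rfl
  rw [hode, truncPow_of_mem hp (hUpos t ht).le h1, min_eq_left h1, max_eq_right (hUpos t ht).le]

/-! ### Laplacians of radial functions -/

section RadialCalculus

variable {n : ℕ}

lemma hasFDerivAt_comp_norm_sq {h : ℝ → ℝ} {h' : ℝ} {x : EuclideanSpace ℝ (Fin n)}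
    (hh : HasDerivAt h h' (‖x‖ ^ 2)) :
    HasFDerivAt (fun y : EuclideanSpace ℝ (Fin n) => h (‖y‖ ^ 2))
      (h' • ((2 : ℝ) • innerSL ℝ x)) x := by
  have h1 : HasFDerivAt (fun y : EuclideanSpace ℝ (Fin n) => ‖y‖ ^ 2) ((2 : ℝ) • innerSL ℝ x) x := by
    have := (hasStrictFDerivAt_norm_sq x).hasFDerivAt
    rwa [← Nat.cast_smul_eq_nsmul ℝ, Nat.cast_ofNat] at this
  exact hh.comp_hasFDerivAt x h1

/-- The Laplacian of a function of the squared norm. -/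
lemma laplacian_comp_norm_sq {h h₁ : ℝ → ℝ} {h₂ : ℝ} {x : EuclideanSpace ℝ (Fin n)}
    (hc : ContDiffAt ℝ 2 (fun y : EuclideanSpace ℝ (Fin n) => h (‖y‖ ^ 2)) x)
    (hh : ∀ᶠ t in 𝓝 (‖x‖ ^ 2), HasDerivAt h (h₁ t) t) (hh₁ : HasDerivAt h₁ h₂ (‖x‖ ^ 2)) :
    Δ (fun y : EuclideanSpace ℝ (Fin n) => h (‖y‖ ^ 2)) x
      = 4 * ‖x‖ ^ 2 * h₂ + 2 * n * h₁ (‖x‖ ^ 2) := by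
  set f : EuclideanSpace ℝ (Fin n) → ℝ := fun y => h (‖y‖ ^ 2) with hf
  have hd : DifferentiableAt ℝ (fderiv ℝ f) x :=
    (hc.fderiv_right (m := 1) (by norm_num)).differentiableAt (by norm_num)
  have hcont : ContinuousAt (fun y : EuclideanSpace ℝ (Fin n) => ‖y‖ ^ 2) x := by fun_prop
  have hev : ∀ᶠ y in 𝓝 x, HasDerivAt h (h₁ (‖y‖ ^ 2)) (‖y‖ ^ 2) := hcont.eventually hh
  -- The Hessian as a quadratic form. Over an orthonormal basis its first term sums to a multiple of
  -- `‖x‖²` and its second to a multiple of the dimension.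
  have key : ∀ w, fderiv ℝ (fderiv ℝ f) x w w
      = h₂ * (2 * inner ℝ x w) * (2 * inner ℝ x w) + h₁ (‖x‖ ^ 2) * (2 * inner ℝ w w) := by
    intro w
    have h1 : HasFDerivAt (fun y => fderiv ℝ f y w) ((fderiv ℝ (fderiv ℝ f) x).flip w) x := by
      have := hd.hasFDerivAt.clm_apply (hasFDerivAt_const w x)
      refine this.congr_fderiv ?_
      ext v
      simp
    have h2 : (fun y => fderiv ℝ f y w) =ᶠ[𝓝 x] fun y => h₁ (‖y‖ ^ 2) * (2 * inner ℝ y w) := by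
      filter_upwards [hev] with y hy
      rw [(hasFDerivAt_comp_norm_sq hy).fderiv]
      simp
    have h3 : HasFDerivAt (fun y : EuclideanSpace ℝ (Fin n) => 2 * inner ℝ y w)
        ((2 : ℝ) • innerSL ℝ w) x := by
      have := ((innerSL ℝ w).hasFDerivAt (x := x)).const_smul (2 : ℝ)
      refine this.congr_of_eventuallyEq (Eventually.of_forall fun y => ?_)
      simp [real_inner_comm]
    have h4 := (hasFDerivAt_comp_norm_sq hh₁).mul h3
    have h5 := (h1.congr_of_eventuallyEq h2.symm).unique h4
    have h6 := congrArg (fun L => L w) h5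
    simp only [ContinuousLinearMap.flip_apply] at h6
    rw [h6]
    simp only [add_apply, smul_apply, innerSL_apply_apply,
      smul_eq_mul]
    ring
  have hsum := congrFun (InnerProductSpace.laplacian_eq_iteratedFDeriv_orthonormalBasis f
    (EuclideanSpace.basisFun (Fin n) ℝ)) x
  rw [hsum]
  have h7 : ∀ i : Fin n, iteratedFDeriv ℝ 2 f x
      ![EuclideanSpace.basisFun (Fin n) ℝ i, EuclideanSpace.basisFun (Fin n) ℝ i]
      = 4 * h₂ * x i ^ 2 + 2 * h₁ (‖x‖ ^ 2) := by
    intro i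
    rw [iteratedFDeriv_two_apply]
    simp only [Matrix.cons_val_zero, Matrix.cons_val_one]
    rw [key]
    have h8 : inner ℝ x (EuclideanSpace.basisFun (Fin n) ℝ i) = x i := by
      rw [real_inner_comm]
      simp [EuclideanSpace.inner_single_left]
    rw [h8, real_inner_self_eq_norm_sq]
    simp only [OrthonormalBasis.norm_eq_one]
    ring
  rw [Finset.sum_congr rfl fun i _ => h7 i, Finset.sum_add_distrib, ← Finset.mul_sum,
    EuclideanSpace.norm_sq_eq]
  simp
  ring

/-- The Laplacian of a radial function away from the origin. -/
lemma laplacian_comp_norm {F F₁ : ℝ → ℝ} {F₂ : ℝ} {x : EuclideanSpace ℝ (Fin n)} (hx : x ≠ 0)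
    (hc : ContDiffAt ℝ 2 (fun y : EuclideanSpace ℝ (Fin n) => F ‖y‖) x)
    (hF : ∀ r, HasDerivAt F (F₁ r) r) (hF₁ : HasDerivAt F₁ F₂ ‖x‖) :
    Δ (fun y : EuclideanSpace ℝ (Fin n) => F ‖y‖) x = F₂ + ((n : ℝ) - 1) / ‖x‖ * F₁ ‖x‖ := by
  have hr : 0 < ‖x‖ := norm_pos_iff.2 hx
  have heq : (fun y : EuclideanSpace ℝ (Fin n) => F ‖y‖)
      = fun y => (fun t => F (Real.sqrt t)) (‖y‖ ^ 2) := by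
    funext y
    simp [Real.sqrt_sq (norm_nonneg y)]
  have hsq : Real.sqrt (‖x‖ ^ 2) = ‖x‖ := Real.sqrt_sq hr.le
  rw [heq] at hc ⊢
  rw [laplacian_comp_norm_sq (h := fun t => F (Real.sqrt t))
    (h₁ := fun t => F₁ (Real.sqrt t) * (1 / (2 * Real.sqrt t)))
    (h₂ := F₂ * (1 / (2 * ‖x‖)) * (1 / (2 * ‖x‖)) - F₁ ‖x‖ * (1 / (4 * ‖x‖ ^ 3))) hc]
  · simp only [hsq]
    field_simp
    ring
  · filter_upwards [lt_mem_nhds (show 0 < ‖x‖ ^ 2 by positivity)] with t ht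
    exact (hF _).comp t (Real.hasDerivAt_sqrt ht.ne')
  · have h1 := Real.hasDerivAt_sqrt (show ‖x‖ ^ 2 ≠ 0 by positivity)
    rw [hsq] at h1
    have h2 : HasDerivAt (fun t => F₁ (Real.sqrt t)) (F₂ * (1 / (2 * ‖x‖))) (‖x‖ ^ 2) := by
      have h3 : HasDerivAt F₁ F₂ (Real.sqrt (‖x‖ ^ 2)) := by rwa [hsq]
      exact h3.comp (‖x‖ ^ 2) h1
    have h4 : HasDerivAt (fun t => 1 / (2 * Real.sqrt t)) (-(1 / (4 * ‖x‖ ^ 3))) (‖x‖ ^ 2) := by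
      have h5 := (h1.const_mul 2).inv (by rw [hsq]; positivity)
      rw [hsq] at h5
      refine (h5.congr_deriv ?_).congr_of_eventuallyEq (Eventually.of_forall fun t => ?_)
      · field_simp
        norm_num
      · simp [one_div]
    refine (h2.mul h4).congr_deriv ?_
    rw [hsq]
    ring

end RadialCalculus

/-! ### Arithmetic of the exponent -/

section Exponents

variable {n : ℕ}

lemma yamabeExponent_pos (hn : 3 ≤ n) : 0 < yamabeExponent n := by
  have hn' : (3 : ℝ) ≤ n := by exact_mod_cast hn
  exact div_pos (by linarith) (by linarith)

lemma one_sub_yamabeExponent : 1 - yamabeExponent n = 4 / ((n : ℝ) + 2) := by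
  have : (n : ℝ) + 2 ≠ 0 := by positivity
  rw [yamabeExponent]
  field_simp
  ring

end Exponents

/-! ### Uniqueness through a first integral -/

/-- A soliton satisfies a first integral along rays. -/
lemma IsRadialSteadySoliton.first_integral {n : ℕ} (hn : 3 ≤ n) {β lam : ℝ}
    {v : EuclideanSpace ℝ (Fin n) → ℝ} (hv : IsRadialSteadySoliton n β lam v)
    {e : EuclideanSpace ℝ (Fin n)} (he : ‖e‖ = 1) :
    ∃ F₁ : ℝ → ℝ, (∀ r, HasDerivAt (fun r : ℝ => v (r • e) ^ yamabeExponent n) (F₁ r) r) ∧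
      ∀ r, 0 ≤ r → r ^ (n - 1) * F₁ r =
        -(yamabeExponent n * β / (2 * ((n : ℝ) - 1))) * (2 * (r ^ n * v (r • e))
          - ((n : ℝ) - 2) * ∫ ρ in (0 : ℝ)..r, ρ ^ (n - 1) * v (ρ • e)) := by
  have hn' : (3 : ℝ) ≤ n := by exact_mod_cast hn
  have hm := yamabeExponent_pos hn
  set m := yamabeExponent n with hmdef
  have hVc : ContDiff ℝ 2 fun y => v y ^ m := hv.contDiff.rpow_const_of_ne fun y => (hv.pos y).ne'
  have hline : ContDiff ℝ 2 fun r : ℝ => r • e := by fun_prop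
  set f : ℝ → ℝ := fun r => v (r • e) with hf
  set F : ℝ → ℝ := fun r => v (r • e) ^ m with hF
  have hfc : ContDiff ℝ 2 f := hv.contDiff.comp hline
  have hFc : ContDiff ℝ 2 F := hVc.comp hline
  have hF1c : ContDiff ℝ 1 (deriv F) := by
    have h2 : ContDiff ℝ (1 + 1) F := by norm_num; exact hFc
    exact (contDiff_succ_iff_deriv.1 h2).2.2
  have hFd : ∀ r, HasDerivAt F (deriv F r) r := fun r =>
    (hFc.differentiable (by norm_num) r).hasDerivAt
  have hF1d : ∀ r, HasDerivAt (deriv F) (deriv (deriv F) r) r := fun r =>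
    (hF1c.differentiable (by norm_num) r).hasDerivAt
  have hfd : ∀ r, HasDerivAt f (deriv f r) r := fun r =>
    (hfc.differentiable (by norm_num) r).hasDerivAt
  have hrad : (fun y => v y ^ m) = fun y => F ‖y‖ := by
    funext y
    simp only [hF]
    rw [hv.radial y (‖y‖ • e) (by rw [norm_smul, he, mul_one, norm_norm])]
  have hode : ∀ r, 0 < r → ((n : ℝ) - 1) / m * (deriv (deriv F) r + ((n : ℝ) - 1) / r * deriv F r)
      + β * (r * deriv f r) + β * ((n : ℝ) + 2) / 2 * f r = 0 := by
    intro r hr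
    have hnorm : ‖r • e‖ = r := by rw [norm_smul, he, mul_one, Real.norm_of_nonneg hr.le]
    have hx : r • e ≠ 0 := norm_pos_iff.1 (by rw [hnorm]; exact hr)
    have h1 := hv.equation (r • e)
    have hcd : ContDiffAt ℝ 2 (fun y : EuclideanSpace ℝ (Fin n) => F ‖y‖) (r • e) := by
      rw [← hrad]
      exact hVc.contDiffAt
    rw [← hmdef, hrad, laplacian_comp_norm hx hcd hFd (by rw [hnorm]; exact hF1d r), hnorm,
      inner_gradient_right, hmdef, one_sub_yamabeExponent, ← hmdef] at h1
    have h2 : HasDerivAt f (fderiv ℝ v (r • e) e) r := by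
      have h3 : HasDerivAt (fun r : ℝ => r • e) e r := by
        simpa using (hasDerivAt_id r).smul_const e
      exact ((hv.contDiff.differentiable (by norm_num)) (r • e)).hasFDerivAt.comp_hasDerivAt r h3
    rw [h2.deriv, ← h1]
    simp only [map_smul, smul_eq_mul, conj_trivial, hf]
    field_simp
    ring
  have hfcont : Continuous f := hfc.continuous
  have hint : Continuous fun ρ : ℝ => ρ ^ (n - 1) * f ρ := by fun_prop
  -- After multiplication by `r^(n-1)` the diffusion term is exact, and the drift and zeroth-order
  -- terms are exact up to `(n-2)/2 * r^(n-1) f`, which stays under the integral. `N` is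
  -- differentiable on the whole line and vanishes at `0`, so the origin needs no limiting argument.
  set N : ℝ → ℝ := fun r => r ^ (n - 1) * deriv F r + m * β / (2 * ((n : ℝ) - 1)) *
    (2 * (r ^ n * f r) - ((n : ℝ) - 2) * ∫ ρ in (0 : ℝ)..r, ρ ^ (n - 1) * f ρ) with hN
  have hNd : ∀ r, HasDerivAt N (((n : ℝ) - 1) * r ^ (n - 2) * deriv F r
      + r ^ (n - 1) * deriv (deriv F) r + m * β / (2 * ((n : ℝ) - 1)) *
        (2 * (n * r ^ (n - 1) * f r + r ^ n * deriv f r)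
          - ((n : ℝ) - 2) * (r ^ (n - 1) * f r))) r := by
    intro r
    have h1 := (hasDerivAt_pow (n - 1) r).mul (hF1d r)
    have h2 := (hasDerivAt_pow n r).mul (hfd r)
    have h3 := intervalIntegral.integral_hasDerivAt_right (hint.intervalIntegrable 0 r)
      hint.stronglyMeasurable.stronglyMeasurableAtFilter hint.continuousAt
    refine (h1.add (((h2.const_mul 2).sub (h3.const_mul ((n : ℝ) - 2))).const_mul
      (m * β / (2 * ((n : ℝ) - 1))))).congr_deriv ?_
    rw [Nat.cast_sub (by omega : 1 ≤ n), Nat.cast_one, Nat.sub_sub]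
  have hN0 : ∀ r, 0 < r → deriv N r = 0 := by
    intro r hr
    rw [(hNd r).deriv]
    have h1 := hode r hr
    obtain ⟨j, rfl⟩ : ∃ j, n = j + 2 := ⟨n - 2, by omega⟩
    have e1 : j + 2 - 1 = j + 1 := rfl
    have e2 : j + 2 - 2 = j := rfl
    rw [e1, e2]
    set N' : ℝ := ((j + 2 : ℕ) : ℝ) with hN'
    have hn1 : N' - 1 ≠ 0 := by linarith
    have hsplit : (N' - 1) * r ^ j * deriv F r + r ^ (j + 1) * deriv (deriv F) r
        + m * β / (2 * (N' - 1)) * (2 * (N' * r ^ (j + 1) * f r + r ^ (j + 2) * deriv f r)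
          - (N' - 2) * (r ^ (j + 1) * f r))
        = r ^ (j + 1) * (m / (N' - 1)) * ((N' - 1) / m * (deriv (deriv F) r
          + (N' - 1) / r * deriv F r) + β * (r * deriv f r) + β * (N' + 2) / 2 * f r) := by
      field_simp
      ring
    rw [hsplit, h1, mul_zero]
  refine ⟨deriv F, hFd, fun r hr => ?_⟩
  have hNr : N r = N 0 := by
    have hmono : MonotoneOn N (Ici 0) := by
      apply monotoneOn_of_deriv_nonneg (convex_Ici 0)
      · exact fun r _ => (hNd r).continuousAt.continuousWithinAt
      · exact fun r _ => (hNd r).differentiableAt.differentiableWithinAt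
      · intro r hr
        rw [interior_Ici] at hr
        exact (hN0 r hr).ge
    have hanti : AntitoneOn N (Ici 0) := by
      apply antitoneOn_of_deriv_nonpos (convex_Ici 0)
      · exact fun r _ => (hNd r).continuousAt.continuousWithinAt
      · exact fun r _ => (hNd r).differentiableAt.differentiableWithinAt
      · intro r hr
        rw [interior_Ici] at hr
        exact (hN0 r hr).le
    exact le_antisymm (hanti (mem_Ici.2 le_rfl) hr hr) (hmono (mem_Ici.2 le_rfl) hr hr)
  have hN00 : N 0 = 0 := by
    simp [hN, zero_pow (show n ≠ 0 by omega), zero_pow (show n - 1 ≠ 0 by omega)]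
  rw [hN00] at hNr
  simp only [hN] at hNr
  linarith

/-- Uniqueness for the first integral of the radial equation: a weighted supremum argument. -/
lemma eq_of_first_integral {n : ℕ} (hn : 3 ≤ n) {k p : ℝ} (hk : 0 < k) (hp : 1 ≤ p)
    {F F₁ G G₁ : ℝ → ℝ} (hF : ∀ r, HasDerivAt F (F₁ r) r) (hG : ∀ r, HasDerivAt G (G₁ r) r)
    (hFpos : ∀ r, 0 < F r) (hGpos : ∀ r, 0 < G r) (h0 : F 0 = G 0)
    (hFi : ∀ r, 0 ≤ r → r ^ (n - 1) * F₁ r = -k * (2 * (r ^ n * F r ^ p)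
          - ((n : ℝ) - 2) * ∫ ρ in (0 : ℝ)..r, ρ ^ (n - 1) * F ρ ^ p))
    (hGi : ∀ r, 0 ≤ r → r ^ (n - 1) * G₁ r = -k * (2 * (r ^ n * G r ^ p)
          - ((n : ℝ) - 2) * ∫ ρ in (0 : ℝ)..r, ρ ^ (n - 1) * G ρ ^ p)) {R : ℝ} (hR : 0 ≤ R) :
    F R = G R := by
  have hn' : (3 : ℝ) ≤ n := by exact_mod_cast hn
  have hFc : Continuous F := continuous_iff_continuousAt.2 fun s => (hF s).continuousAt
  have hGc : Continuous G := continuous_iff_continuousAt.2 fun s => (hG s).continuousAt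
  have hFp : Continuous fun r => F r ^ p := hFc.rpow_const fun r => Or.inl (hFpos r).ne'
  have hGp : Continuous fun r => G r ^ p := hGc.rpow_const fun r => Or.inl (hGpos r).ne'
  obtain ⟨M₁, hM₁⟩ := (isCompact_Icc (a := (0 : ℝ)) (b := R)).exists_bound_of_continuousOn
    hFc.continuousOn
  obtain ⟨M₂, hM₂⟩ := (isCompact_Icc (a := (0 : ℝ)) (b := R)).exists_bound_of_continuousOn
    hGc.continuousOn
  set M := max M₁ M₂ with hM
  have hFM : ∀ r ∈ Icc 0 R, F r ≤ M := fun r hr =>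
    (le_abs_self _).trans ((hM₁ r hr).trans (le_max_left _ _))
  have hGM : ∀ r ∈ Icc 0 R, G r ≤ M := fun r hr =>
    (le_abs_self _).trans ((hM₂ r hr).trans (le_max_right _ _))
  have hM0 : 0 ≤ M := (hFpos 0).le.trans (hFM 0 ⟨le_rfl, hR⟩)
  set Lc := p * M ^ (p - 1) with hLc
  have hLc0 : 0 ≤ Lc := mul_nonneg (by linarith) (Real.rpow_nonneg hM0 _)
  have hlip : ∀ x ∈ Icc 0 M, ∀ y ∈ Icc 0 M, |x ^ p - y ^ p| ≤ Lc * |x - y| := by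
    intro x hx y hy
    have := Convex.norm_image_sub_le_of_norm_hasDerivWithin_le (f := fun x : ℝ => x ^ p)
      (f' := fun x => p * x ^ (p - 1)) (C := Lc) (s := Icc 0 M) (x := y) (y := x)
      (fun z _ => (Real.hasDerivAt_rpow_const (Or.inr hp)).hasDerivWithinAt)
      (fun z hz => by
        rw [Real.norm_of_nonneg (mul_nonneg (by linarith) (Real.rpow_nonneg hz.1 _))]
        exact mul_le_mul_of_nonneg_left (Real.rpow_le_rpow hz.1 hz.2 (by linarith))
          (by linarith)) (convex_Icc _ _) hy hx
    simpa using this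
  -- `k n R Lc` bounds the effect of the nonlinearity on the derivative, with `n = 2 + (n-2)`
  -- collecting the two terms. The summand `1` keeps `C` positive when `R` or `Lc` vanishes.
  set C := k * (n * R * Lc) + 1 with hC
  have hC0 : 0 < C := by positivity
  obtain ⟨r₀, hr₀, hmax⟩ := (isCompact_Icc (a := (0 : ℝ)) (b := R)).exists_isMaxOn
    (nonempty_Icc.2 hR) (f := fun r => Real.exp (-(2 * C * r)) * |F r - G r|)
    (Continuous.continuousOn (by fun_prop))
  set W := Real.exp (-(2 * C * r₀)) * |F r₀ - G r₀| with hW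
  have hW0 : 0 ≤ W := by positivity
  have hle : ∀ r ∈ Icc 0 R, |F r - G r| ≤ W * Real.exp (2 * C * r) := by
    intro r hr
    have h1 : Real.exp (-(2 * C * r)) * |F r - G r| ≤ W := hmax hr
    rwa [Real.exp_neg, inv_mul_le_iff₀ (Real.exp_pos _), mul_comm] at h1
  have hder : ∀ r ∈ Ioo 0 R, |F₁ r - G₁ r| ≤ C * W * Real.exp (2 * C * r) := by
    intro r hr
    have hX0 : 0 ≤ Lc * (W * Real.exp (2 * C * r)) := by positivity
    have hpt : ∀ ρ ∈ Icc 0 r, |F ρ ^ p - G ρ ^ p| ≤ Lc * (W * Real.exp (2 * C * r)) := by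
      intro ρ hρ
      have hρR : ρ ∈ Icc 0 R := ⟨hρ.1, hρ.2.trans hr.2.le⟩
      refine (hlip _ ⟨(hFpos ρ).le, hFM ρ hρR⟩ _ ⟨(hGpos ρ).le, hGM ρ hρR⟩).trans ?_
      refine mul_le_mul_of_nonneg_left ((hle ρ hρR).trans ?_) hLc0
      exact mul_le_mul_of_nonneg_left (Real.exp_le_exp.2
        (mul_le_mul_of_nonneg_left hρ.2 (by linarith))) hW0
    set X := Lc * (W * Real.exp (2 * C * r)) with hX
    have hi : |(∫ ρ in (0 : ℝ)..r, ρ ^ (n - 1) * F ρ ^ p)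
        - ∫ ρ in (0 : ℝ)..r, ρ ^ (n - 1) * G ρ ^ p| ≤ r ^ (n - 1) * X * r := by
      rw [← intervalIntegral.integral_sub (Continuous.intervalIntegrable (by fun_prop) _ _)
        (Continuous.intervalIntegrable (by fun_prop) _ _)]
      have := intervalIntegral.norm_integral_le_of_norm_le_const (a := (0 : ℝ)) (b := r)
        (f := fun ρ : ℝ => ρ ^ (n - 1) * F ρ ^ p - ρ ^ (n - 1) * G ρ ^ p)
        (C := r ^ (n - 1) * X) (by
          intro ρ hρ
          rw [uIoc_of_le hr.1.le] at hρ
          rw [← mul_sub, norm_mul, Real.norm_of_nonneg (pow_nonneg hρ.1.le _)]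
          exact mul_le_mul (pow_le_pow_left₀ hρ.1.le hρ.2 _) (hpt ρ ⟨hρ.1.le, hρ.2⟩)
            (norm_nonneg _) (pow_nonneg hr.1.le _))
      rwa [sub_zero, abs_of_pos hr.1, Real.norm_eq_abs] at this
    have hpow : r ^ n = r ^ (n - 1) * r := by rw [← pow_succ]; congr 1; omega
    have hrp : 0 < r ^ (n - 1) := pow_pos hr.1 _
    have heq : r ^ (n - 1) * (F₁ r - G₁ r) = -k * (2 * (r ^ (n - 1) * r) * (F r ^ p - G r ^ p)
        - ((n : ℝ) - 2) * ((∫ ρ in (0 : ℝ)..r, ρ ^ (n - 1) * F ρ ^ p)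
        - ∫ ρ in (0 : ℝ)..r, ρ ^ (n - 1) * G ρ ^ p)) := by
      rw [mul_sub, hFi r hr.1.le, hGi r hr.1.le, hpow]
      ring
    have habs : r ^ (n - 1) * |F₁ r - G₁ r| ≤ k * (n * (r ^ (n - 1) * X * r)) := by
      rw [← abs_of_pos hrp, ← abs_mul, abs_of_pos hrp, heq, abs_mul, abs_neg, abs_of_pos hk]
      refine mul_le_mul_of_nonneg_left ?_ hk.le
      refine (abs_sub _ _).trans ?_
      rw [abs_mul, abs_mul (((n : ℝ) - 2)), abs_of_nonneg (by linarith : (0 : ℝ) ≤ n - 2),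
        abs_of_nonneg (mul_nonneg zero_le_two (mul_nonneg hrp.le hr.1.le))]
      have h1 := mul_le_mul_of_nonneg_left (hpt r ⟨hr.1.le, le_rfl⟩)
        (mul_nonneg zero_le_two (mul_nonneg hrp.le hr.1.le))
      have h2 := mul_le_mul_of_nonneg_left hi (by linarith : (0 : ℝ) ≤ n - 2)
      linarith
    have h3 : |F₁ r - G₁ r| ≤ k * (n * (X * r)) := by
      refine le_of_mul_le_mul_left (habs.trans (le_of_eq ?_)) hrp
      ring
    have h4 : k * (n * (X * r)) ≤ k * (n * (X * R)) := by
      have := hr.2.le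
      gcongr
    refine h3.trans (h4.trans ?_)
    have h5 : 0 ≤ W * Real.exp (2 * C * r) := by positivity
    rw [hC, hX]
    rw [hC] at h5
    linarith
  -- Integrating the derivative bound `C W exp (2 C r)` halves the constant. At the point where the
  -- weighted maximum `W` is attained this gives `W ≤ W / 2`, hence `W = 0`.
  have hstep : ∀ σ : ℝ, |σ| = 1 → σ * (F r₀ - G r₀) ≤ W / 2 * Real.exp (2 * C * r₀) := by
    intro σ hσ
    have hd : ∀ r, HasDerivAt (fun r => W / 2 * Real.exp (2 * C * r) - σ * (F r - G r))
        (C * W * Real.exp (2 * C * r) - σ * (F₁ r - G₁ r)) r := by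
      intro r
      have h1 : HasDerivAt (fun r => 2 * C * r) (2 * C) r := by
        simpa using (hasDerivAt_id r).const_mul (2 * C)
      refine ((h1.exp.const_mul (W / 2)).sub (((hF r).sub (hG r)).const_mul σ)).congr_deriv ?_
      ring
    have hm : MonotoneOn (fun r => W / 2 * Real.exp (2 * C * r) - σ * (F r - G r)) (Icc 0 R) := by
      apply monotoneOn_of_deriv_nonneg (convex_Icc _ _)
      · exact fun r _ => (hd r).continuousAt.continuousWithinAt
      · exact fun r _ => (hd r).differentiableAt.differentiableWithinAt
      · intro r hr
        rw [interior_Icc] at hr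
        rw [(hd r).deriv]
        have h1 := le_abs_self (σ * (F₁ r - G₁ r))
        rw [abs_mul, hσ, one_mul] at h1
        linarith [hder r hr]
    have h1 := hm (left_mem_Icc.2 hR) hr₀ hr₀.1
    simp only [mul_zero, Real.exp_zero, h0, sub_self, sub_zero, mul_one] at h1
    linarith
  have hfin : |F r₀ - G r₀| ≤ W / 2 * Real.exp (2 * C * r₀) := by
    rw [abs_le]
    have h1 := hstep 1 (by simp)
    have h2 := hstep (-1) (by simp)
    constructor <;> linarith
  have hW2 : W ≤ W / 2 := by
    have h1 := mul_le_mul_of_nonneg_left hfin (Real.exp_pos (-(2 * C * r₀))).le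
    have h2 : Real.exp (-(2 * C * r₀)) * (W / 2 * Real.exp (2 * C * r₀)) = W / 2 := by
      rw [mul_comm, mul_assoc, ← Real.exp_add]
      simp
    rw [h2] at h1
    exact h1
  have hWz : W = 0 := by linarith
  have h1 := hle R ⟨hR, le_rfl⟩
  rw [hWz, zero_mul] at h1
  exact sub_eq_zero.1 (abs_nonpos_iff.1 h1)

/-- Solitons are determined by their value at the origin. -/
theorem IsRadialSteadySoliton.unique {n : ℕ} (hn : 3 ≤ n) {β lam : ℝ} (hβ : 0 < β)
    {u v : EuclideanSpace ℝ (Fin n) → ℝ} (hu : IsRadialSteadySoliton n β lam u)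
    (hv : IsRadialSteadySoliton n β lam v) : v = u := by
  have hn' : (3 : ℝ) ≤ n := by exact_mod_cast hn
  have hm := yamabeExponent_pos hn
  have hm1 : yamabeExponent n ≤ 1 := by
    have : 0 ≤ 1 - yamabeExponent n := by
      rw [one_sub_yamabeExponent]
      positivity
    linarith
  set e : EuclideanSpace ℝ (Fin n) := EuclideanSpace.single ⟨0, by omega⟩ 1 with he
  have hen : ‖e‖ = 1 := by simp [he]
  obtain ⟨F₁, hF, hFi⟩ := hu.first_integral hn hen
  obtain ⟨G₁, hG, hGi⟩ := hv.first_integral hn hen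
  have hk : 0 < yamabeExponent n * β / (2 * ((n : ℝ) - 1)) :=
    div_pos (mul_pos hm hβ) (by linarith)
  have hinv : ∀ w : EuclideanSpace ℝ (Fin n) → ℝ, (∀ x, 0 < w x) → ∀ x,
      w x = (w x ^ yamabeExponent n) ^ (1 / yamabeExponent n) := by
    intro w hw x
    rw [← Real.rpow_mul (hw x).le, mul_one_div_cancel hm.ne', Real.rpow_one]
  have heq : ∀ r : ℝ, 0 ≤ r → u (r • e) ^ yamabeExponent n = v (r • e) ^ yamabeExponent n := by
    intro r hr
    refine eq_of_first_integral hn hk (p := 1 / yamabeExponent n) (one_le_one_div hm hm1) hF hG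
      (fun r => Real.rpow_pos_of_pos (hu.pos _) _) (fun r => Real.rpow_pos_of_pos (hv.pos _) _)
      ?_ ?_ ?_ hr
    · simp only [zero_smul, hu.apply_zero, hv.apply_zero]
    · simp only [← hinv u hu.pos]
      exact hFi
    · simp only [← hinv v hv.pos]
      exact hGi
  funext x
  have hx : ‖x‖ = ‖‖x‖ • e‖ := by rw [norm_smul, hen, mul_one, norm_norm]
  rw [hu.radial x _ hx, hv.radial x _ hx, hinv u hu.pos, hinv v hv.pos, heq _ (norm_nonneg x)]

/-! ### Scaling and cylindrical variables -/

/-- The soliton attached to a radial profile `U` of the normalized equation. -/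
lemma isRadialSteadySoliton_of_profile {n : ℕ} (hn : 3 ≤ n) {p : ℝ}
    (hpn : ((n : ℝ) - 2) * p = n + 2) {U U₁ U₂ : ℝ → ℝ} (hU0 : U 0 = 1)
    (hU : ∀ t, HasDerivAt U (U₁ t) t) (hU₁ : ∀ t, HasDerivAt U₁ (U₂ t) t) (hU₂ : Continuous U₂)
    (hpos : ∀ t, 0 ≤ t → 0 < U t)
    (hode : ∀ t, 0 ≤ t → t * U₂ t + n / 2 * U₁ t =
        -(yamabeExponent n / (4 * ((n : ℝ) - 1))) *
          (2 * t * (p * U t ^ (p - 1) * U₁ t) + (n + 2) / 2 * U t ^ p))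
    {β lam : ℝ} (hβ : 0 < β) (hlam : 0 < lam) :
    IsRadialSteadySoliton n β lam
      fun x => lam * U (β * lam ^ (1 - yamabeExponent n) * ‖x‖ ^ 2) ^ p := by
  have hn' : (3 : ℝ) ≤ n := by exact_mod_cast hn
  have hm := yamabeExponent_pos hn
  have hmp : p * yamabeExponent n = 1 := by
    rw [yamabeExponent]
    have h1 : (n : ℝ) + 2 ≠ 0 := by positivity
    field_simp
    linarith
  have hgam : 2 * β / (1 - yamabeExponent n) = β * (n + 2) / 2 := by
    rw [one_sub_yamabeExponent]
    field_simp
    ring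
  -- The scale of `‖x‖²` is chosen so that diffusion, of size `lam^m B`, balances drift, of size `β
  -- lam`.
  have hBdef : lam ^ yamabeExponent n * (β * lam ^ (1 - yamabeExponent n)) = β * lam := by
    rw [mul_left_comm, ← Real.rpow_add hlam, add_sub_cancel, Real.rpow_one]
  have hB0 : 0 < β * lam ^ (1 - yamabeExponent n) := mul_pos hβ (Real.rpow_pos_of_pos hlam _)
  set B := β * lam ^ (1 - yamabeExponent n) with hB
  set m := yamabeExponent n with hmdef
  have hUc2 : ContDiff ℝ 2 U := by
    have h1 : deriv U = U₁ := funext fun t => (hU t).deriv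
    have h2 : deriv U₁ = U₂ := funext fun t => (hU₁ t).deriv
    have h3 : ContDiff ℝ 1 U₁ :=
      contDiff_one_iff_deriv.2 ⟨fun t => (hU₁ t).differentiableAt, by rwa [h2]⟩
    have h4 : ContDiff ℝ (1 + 1) U :=
      contDiff_succ_iff_deriv.2 ⟨fun t => (hU t).differentiableAt, by simp, by rwa [h1]⟩
    norm_num at h4
    exact h4
  have hin : ContDiff ℝ 2 fun x : EuclideanSpace ℝ (Fin n) => B * ‖x‖ ^ 2 :=
    contDiff_const.mul (contDiff_norm_sq ℝ)
  have hUin : ContDiff ℝ 2 fun x : EuclideanSpace ℝ (Fin n) => U (B * ‖x‖ ^ 2) := hUc2.comp hin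
  have hposx : ∀ x : EuclideanSpace ℝ (Fin n), 0 < U (B * ‖x‖ ^ 2) := fun x =>
    hpos _ (by positivity)
  have hpow : (fun x : EuclideanSpace ℝ (Fin n) => (lam * U (B * ‖x‖ ^ 2) ^ p) ^ m)
      = fun x => (fun t => lam ^ m * U (B * t)) (‖x‖ ^ 2) := by
    funext x
    rw [Real.mul_rpow hlam.le (Real.rpow_nonneg (hposx x).le _), ← Real.rpow_mul (hposx x).le,
      hmp, Real.rpow_one]
  have hBd : ∀ t : ℝ, HasDerivAt (fun t => B * t) B t := fun t => by
    simpa using (hasDerivAt_id t).const_mul B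
  refine ⟨contDiff_const.mul (hUin.rpow_const_of_ne fun x => (hposx x).ne'),
    fun x => mul_pos hlam (Real.rpow_pos_of_pos (hposx x) _),
    fun x y hxy => by simp only [hxy], fun x => ?_, by simp [hU0]⟩
  have hlap := laplacian_comp_norm_sq (x := x) (h := fun t => lam ^ m * U (B * t))
    (h₁ := fun t => lam ^ m * (U₁ (B * t) * B)) (h₂ := lam ^ m * (U₂ (B * ‖x‖ ^ 2) * B * B))
    (contDiff_const.mul hUin).contDiffAt
    (Eventually.of_forall fun t => ((hU (B * t)).comp t (hBd t)).const_mul _)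
    ((((hU₁ (B * ‖x‖ ^ 2)).comp (‖x‖ ^ 2) (hBd _)).mul_const B).const_mul _)
  have hgrad := (hasFDerivAt_comp_norm_sq (x := x) (h := fun t => lam * U (B * t) ^ p)
    ((((hU (B * ‖x‖ ^ 2)).comp (‖x‖ ^ 2) (hBd _)).rpow_const
      (Or.inl (hposx x).ne')).const_mul lam)).fderiv
  rw [hpow, hlap, inner_gradient_right, hgrad, hgam]
  have h1 := hode (B * ‖x‖ ^ 2) (by positivity)
  simp only [smul_apply, innerSL_apply_apply, smul_eq_mul,
    conj_trivial, real_inner_self_eq_norm_sq, Function.comp]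
  generalize ‖x‖ ^ 2 = t at *
  have h2 : ((n : ℝ) - 1) / m * (4 * t * (lam ^ m * (U₂ (B * t) * B * B))
      + 2 * n * (lam ^ m * (U₁ (B * t) * B)))
      = ((n : ℝ) - 1) / m * 4 * (lam ^ m * B) * (B * t * U₂ (B * t) + n / 2 * U₁ (B * t)) := by
    ring
  have hn1 : (n : ℝ) - 1 ≠ 0 := by linarith
  rw [h2, h1, hBdef]
  field_simp
  ring

/-- The cylindrical system satisfied by `w = r² u ^ (1 - m)` and its logarithmic derivative. -/
lemma hasDerivAt_cylindrical_system {n : ℕ} (hn : 3 ≤ n) {p : ℝ}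
    (hpn : ((n : ℝ) - 2) * p = n + 2) {U U₁ U₂ : ℝ → ℝ}
    (hU : ∀ t, HasDerivAt U (U₁ t) t) (hU₁ : ∀ t, HasDerivAt U₁ (U₂ t) t)
    (hpos : ∀ t, 0 ≤ t → 0 < U t)
    (hode : ∀ t, 0 ≤ t → t * U₂ t + n / 2 * U₁ t =
        -(yamabeExponent n / (4 * ((n : ℝ) - 1))) *
          (2 * t * (p * U t ^ (p - 1) * U₁ t) + (n + 2) / 2 * U t ^ p)) (s : ℝ) :
    HasDerivAt (fun s => Real.exp (2 * s) * U (Real.exp (2 * s)) ^ (p - 1))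
      (Real.exp (2 * s) * U (Real.exp (2 * s)) ^ (p - 1) *
        (2 + 8 / ((n : ℝ) - 2) * (Real.exp (2 * s) * U₁ (Real.exp (2 * s))
          / U (Real.exp (2 * s))))) s ∧
    HasDerivAt (fun s => 2 + 8 / ((n : ℝ) - 2) * (Real.exp (2 * s) * U₁ (Real.exp (2 * s))
          / U (Real.exp (2 * s))))
      (4 * (((n : ℝ) - 2) / 4) - ((n : ℝ) - 2) / 4 *
        (2 + 8 / ((n : ℝ) - 2) * (Real.exp (2 * s) * U₁ (Real.exp (2 * s))
          / U (Real.exp (2 * s)))) ^ 2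
        - 1 / ((n : ℝ) - 1) * (Real.exp (2 * s) * U (Real.exp (2 * s)) ^ (p - 1)) *
        (2 + 8 / ((n : ℝ) - 2) * (Real.exp (2 * s) * U₁ (Real.exp (2 * s))
          / U (Real.exp (2 * s))))) s := by
  have hn' : (3 : ℝ) ≤ n := by exact_mod_cast hn
  have hn2 : (n : ℝ) - 2 ≠ 0 := by linarith
  have hn1 : (n : ℝ) - 1 ≠ 0 := by linarith
  have hn4 : (n : ℝ) + 2 ≠ 0 := by linarith
  have hp : p = (n + 2) / (n - 2) := by rw [eq_div_iff hn2]; linarith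
  have hE : HasDerivAt (fun s : ℝ => Real.exp (2 * s)) (2 * Real.exp (2 * s)) s := by
    have h1 : HasDerivAt (fun s : ℝ => 2 * s) 2 s := by
      simpa using (hasDerivAt_id s).const_mul (2 : ℝ)
    exact h1.exp.congr_deriv (by ring)
  have hUE := (hU (Real.exp (2 * s))).comp s hE
  have hU₁E := (hU₁ (Real.exp (2 * s))).comp s hE
  have hUp := hpos (Real.exp (2 * s)) (Real.exp_pos _).le
  have h1 := hode (Real.exp (2 * s)) (Real.exp_pos _).le
  have ht := Real.exp_pos (2 * s)
  constructor
  · refine (hE.mul (hUE.rpow_const (Or.inl hUp.ne'))).congr_deriv ?_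
    simp only [Function.comp]
    generalize Real.exp (2 * s) = t at *
    rw [Real.rpow_sub_one hUp.ne' (p - 1), hp]
    have := hUp.ne'
    field_simp
    ring
  · refine ((((hE.mul hU₁E).div hUE hUp.ne').const_mul (8 / ((n : ℝ) - 2))).const_add
      2).congr_deriv ?_
    simp only [Function.comp, Pi.mul_apply]
    generalize Real.exp (2 * s) = t at *
    have h2 : U t ^ p = U t ^ (p - 1) * U t := by
      rw [Real.rpow_sub_one hUp.ne', div_mul_cancel₀ _ hUp.ne']
    rw [h2] at h1
    have h3 : t * U₂ t = -(n / 2 * U₁ t) - (yamabeExponent n / (4 * ((n : ℝ) - 1))) *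
          (2 * t * (p * U t ^ (p - 1) * U₁ t) + (n + 2) / 2 * (U t ^ (p - 1) * U t)) := by
      linarith
    generalize U t ^ (p - 1) = Z at *
    have h4 : U₂ t = (-(n / 2 * U₁ t) - (yamabeExponent n / (4 * ((n : ℝ) - 1))) *
          (2 * t * (p * Z * U₁ t) + (n + 2) / 2 * (Z * U t))) / t := by
      rw [eq_div_iff ht.ne', ← h3]
      ring
    rw [h4, hp, yamabeExponent]
    have := hUp.ne'
    field_simp
    ring

/-! ### The expansion in the original variables -/

/-- A shift of time by `δ` changes only the constant term: replacing `1 / (s + δ)` by `1 / s` costs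
`o(1/s)`, because `s / (s + δ) → 1`. -/
lemma exists_isLittleO_expansion {w : ℝ → ℝ} {A K θ : ℝ} (hA : 0 < A)
    (h : Tendsto (fun s => s * (w s - A * s - K)) atTop (𝓝 (A * θ))) (δ : ℝ) :
    Asymptotics.IsLittleO atTop
      (fun r => w (Real.log r + δ) / A - (Real.log r + (δ + K / A) + θ * (1 / Real.log r)))
      (fun r : ℝ => 1 / Real.log r) := by
  have hshift : Tendsto (fun s : ℝ => s + δ) atTop atTop :=
    tendsto_atTop_add_const_right _ δ tendsto_id
  have h1 := (h.comp hshift).const_mul (1 / A)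
  have h2 : Tendsto (fun s : ℝ => s / (s + δ)) atTop (𝓝 1) := by
    have h3 : Tendsto (fun s : ℝ => 1 - δ / (s + δ)) atTop (𝓝 (1 - 0)) :=
      (hshift.const_div_atTop δ).const_sub 1
    rw [sub_zero] at h3
    refine h3.congr' ?_
    filter_upwards [hshift.eventually_gt_atTop 0] with s hs
    field_simp
    ring
  have h4 := (h1.mul h2).sub_const θ
  have h5 : 1 / A * (A * θ) * 1 - θ = 0 := by field_simp; ring
  rw [h5] at h4
  have h6 := h4.comp Real.tendsto_log_atTop
  rw [Asymptotics.isLittleO_iff_tendsto']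
  · refine h6.congr' ?_
    filter_upwards [Real.tendsto_log_atTop.eventually_gt_atTop 0,
      Real.tendsto_log_atTop.eventually (hshift.eventually_gt_atTop 0)] with r hr hr'
    simp only [Function.comp]
    field_simp
    ring
  · filter_upwards [Real.tendsto_log_atTop.eventually_gt_atTop 0] with r hr h0
    exact absurd h0 (one_div_pos.2 hr).ne'

theorem proposition2p5 (n : ℕ) (hn : 3 ≤ n) :
    ∃ κ : ℝ, ∀ β lam : ℝ, 0 < β → 0 < lam →
      ∃ u : EuclideanSpace ℝ (Fin n) → ℝ,
        IsRadialSteadySoliton n β lam u ∧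
        (∀ v : EuclideanSpace ℝ (Fin n) → ℝ, IsRadialSteadySoliton n β lam v → v = u) ∧
        ∃ e : ℝ → ℝ,
          Asymptotics.IsLittleO Filter.atTop e (fun r : ℝ => 1 / Real.log r) ∧
          ∀ x : EuclideanSpace ℝ (Fin n), 1 < ‖x‖ →
            u x ^ (1 - yamabeExponent n) =
              ((n : ℝ) - 1) * ((n : ℝ) - 2) / (β * ‖x‖ ^ 2) *
                (Real.log ‖x‖
                  + (2 * Real.log lam / ((n : ℝ) + 2) + Real.log β / 2 + κ)
                  + ((n : ℝ) - 6) / (4 * ((n : ℝ) - 2)) * (1 / Real.log ‖x‖)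
                  + e ‖x‖) := by
  have hn' : (3 : ℝ) ≤ n := by exact_mod_cast hn
  have hn2 : 0 < (n : ℝ) - 2 := by linarith
  have hn1 : 0 < (n : ℝ) - 1 := by linarith
  have hm := yamabeExponent_pos hn
  set p : ℝ := ((n : ℝ) + 2) / (n - 2) with hp
  have hpn : ((n : ℝ) - 2) * p = n + 2 := mul_div_cancel₀ _ hn2.ne'
  obtain ⟨U, U₁, U₂, hU0, hU, hU₁, hU₂, hpos, hneg, hY, hode⟩ :=
    exists_radial_profile hn (k := yamabeExponent n / (4 * ((n : ℝ) - 1)))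
      (div_pos hm (by linarith)) hpn
  have hsys := hasDerivAt_cylindrical_system hn hpn hU hU₁ hpos hode
  set A : ℝ := ((n : ℝ) - 1) * (n - 2) with hA
  have hA0 : 0 < A := mul_pos hn1 hn2
  obtain ⟨K, hK⟩ := exists_expansion_of_cylindrical_system (q := ((n : ℝ) - 2) / 4)
    (c := 1 / ((n : ℝ) - 1)) (by linarith) (one_div_pos.2 hn1)
    (fun s => mul_pos (Real.exp_pos _) (Real.rpow_pos_of_pos (hpos _ (Real.exp_pos _).le) _))
    (fun s => by
      have ht := Real.exp_pos (2 * s)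
      have h1 := hY _ ht.le
      have h2 := hpos _ ht.le
      have h3 : 2 + 8 / ((n : ℝ) - 2) * (Real.exp (2 * s) * U₁ (Real.exp (2 * s))
          / U (Real.exp (2 * s))) = 4 / (((n : ℝ) - 2) * U (Real.exp (2 * s))) *
          (((n : ℝ) - 2) / 2 * U (Real.exp (2 * s))
            + 2 * Real.exp (2 * s) * U₁ (Real.exp (2 * s))) := by
        have := h2.ne'
        field_simp
        ring
      rw [h3]
      positivity)
    (fun s => by
      have ht := Real.exp_pos (2 * s)
      have h1 : Real.exp (2 * s) * U₁ (Real.exp (2 * s)) / U (Real.exp (2 * s)) ≤ 0 :=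
        div_nonpos_of_nonpos_of_nonneg (mul_nonpos_of_nonneg_of_nonpos ht.le (hneg _ ht.le))
          (hpos _ ht.le).le
      have h2 : 0 ≤ 8 / ((n : ℝ) - 2) := by positivity
      have h3 := mul_nonpos_of_nonneg_of_nonpos h2 h1
      linarith)
    (fun s => (hsys s).1) (fun s => (hsys s).2)
  have hAeq : 4 * (((n : ℝ) - 2) / 4) / (1 / ((n : ℝ) - 1)) = A := by
    rw [hA]
    field_simp
  have hθ : (((n : ℝ) - 2) / 4 - 1) / (1 / ((n : ℝ) - 1))
      = A * (((n : ℝ) - 6) / (4 * ((n : ℝ) - 2))) := by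
    rw [hA]
    field_simp
    ring
  rw [hAeq, hθ] at hK
  -- `K` comes from the normalized profile, fixed before `β` and `lam` are introduced; this is why
  -- the constant depends on `n` only.
  refine ⟨K / A, fun β lam hβ hlam => ?_⟩
  have hsol := isRadialSteadySoliton_of_profile hn hpn hU0 hU hU₁ hU₂ hpos hode hβ hlam
  refine ⟨_, hsol, fun v hv => hsol.unique hn hβ hv, _,
    exists_isLittleO_expansion hA0 hK (2 * Real.log lam / ((n : ℝ) + 2) + Real.log β / 2), ?_⟩
  intro x hx
  have hx0 : 0 < ‖x‖ := by linarith
  have hl : 0 < lam ^ (1 - yamabeExponent n) := Real.rpow_pos_of_pos hlam _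
  have hexp : Real.exp (2 * (Real.log ‖x‖ + (2 * Real.log lam / ((n : ℝ) + 2) + Real.log β / 2)))
      = β * lam ^ (1 - yamabeExponent n) * ‖x‖ ^ 2 := by
    have h1 : 2 * (Real.log ‖x‖ + (2 * Real.log lam / ((n : ℝ) + 2) + Real.log β / 2))
        = Real.log (β * lam ^ (1 - yamabeExponent n) * ‖x‖ ^ 2) := by
      rw [Real.log_mul (mul_pos hβ hl).ne' (by positivity), Real.log_mul hβ.ne' hl.ne',
        Real.log_rpow hlam, Real.log_pow, one_sub_yamabeExponent]
      push_cast
      ring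
    rw [h1, Real.exp_log (by positivity)]
  have hUx : 0 < U (β * lam ^ (1 - yamabeExponent n) * ‖x‖ ^ 2) := hpos _ (by positivity)
  have hpm : p * (1 - yamabeExponent n) = p - 1 := by
    rw [one_sub_yamabeExponent, hp]
    field_simp
    ring
  rw [Real.mul_rpow hlam.le (Real.rpow_nonneg hUx.le _), ← Real.rpow_mul hUx.le, hpm]
  -- The error `e` is the exact remainder of the expansion, so the required formula reduces to `r²
  -- u^(1-m) = w / β` at the shifted time given by `hexp`.
  have hcancel : ∀ a b c d : ℝ, a + (b + K / A) + c + (d / A - (a + (b + K / A) + c)) = d / A :=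
    fun a b c d => by ring
  rw [hcancel]
  simp only [hexp]
  field_simp
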